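/- Let $G$ be a finite simple undirected $4K_1$-free graph (i.e. $G$ has no four pairwise non-adjacent vertices), and let $u,v$ be two distinct vertices of $G$. For $A\subseteq V(G)$, $G[A]$ is the subgraph induced by $A$ and $G-A=G[V(G)\setminus A]$; $c(H)$ is the number of connected components of a graph $H$; an articulation point of $H$ is a vertex $x$ of $H$ such that $H-\{x\}$ is disconnected. We say that $G$ has a $\mathrm{PC}(u,v)$ if there are two vertex-disjoint paths in $G$ (a single vertex counts as a path), one starting in $u$ and the other one starting in $v$, that together contain all vertices of $G$. If $G$ is connected, then $G$ has a $\mathrm{PC}(u,v)$ if and only if the following conditions are satisfied. (a) For every articulation point $x$ of $G$ such that $G-\{x\}$ has at least 3 components, $u,v$ are different from $x$ and belong to different components of $G-\{x\}$. (b) For any three articulation points $x,y,z$ of $G$ inducing a triangle in $G$: if both $u,v$ are different from $x,y,z$, then $u,v$ are not in the same component of $G-\{x,y,z\}$; if exactly one of $u,v$ is in $\{x,y,z\}$, then the other one is not in a component of $G-\{x,y,z\}$ that contains a neighbour of the first one. (c) The pair $\{u,v\}$ does not form a vertex cut (not necessarily minimum) in $G$ such that $c(G-\{u,v\})\ge 3$.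 (d) Let $x\ne u$ be an articulation point of $G$ such that $c(G-\{x\})\le 2$, and let $Q_1$ be the component of $G-\{x\}$ containing $u$. Suppose that $G[Q_1]$ contains an articulation point $y\ne u$, and denote the component of $G[Q_1]-\{y\}$ containing $u$ by $J_1$. If $v\in J_1$, $|J_1|>2$, and all neighbours of $x$ in $Q_1$ belong to $J_1\cup\{y\}$, then there exists $x'\in J_1$, $x'\ne u,v$, adjacent to $x$ or $y$. If $G$ is not connected, then $G$ has a $\mathrm{PC}(u,v)$ if and only if $G$ has exactly 2 components, $u,v$ are in different components, and none of $u,v$ is an articulation point of its component. -/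

import Mathlib

open SimpleGraph

namespace PathCover

variable {V : Type*}

/-- `G` is `kK₁`-free: it has no induced subgraph isomorphic to the edgeless graph
on `k` vertices. -/
def KOneFree (G : SimpleGraph V) (k : ℕ) : Prop :=
  ¬ (⊥ : SimpleGraph (Fin k)).IsIndContained G

/-- The number of connected components of the induced subgraph `G[S]`.
For `S = Aᶜ` this is the number of components of `G - A`. -/
noncomputable def numComponents (G : SimpleGraph V) (S : Set V) : ℕ :=
  Nat.card (G.induce S).ConnectedComponent

/-- `Q` is (the vertex set of) a connected component of the induced subgraph `G[S]`.
For `S = Aᶜ` these are the components of `G - A`. -/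
def IsComponent (G : SimpleGraph V) (S Q : Set V) : Prop :=
  ∃ C : (G.induce S).ConnectedComponent, Q = Subtype.val '' C.supp

/-- `x` is an articulation point of the induced subgraph `G[S]`: it is a vertex of `G[S]`,
and `G[S] - {x} = G[S \ {x}]` is disconnected. (The graph without vertices does not count
as disconnected.) -/
def IsArticulationPointOf (G : SimpleGraph V) (S : Set V) (x : V) : Prop :=
  x ∈ S ∧ ¬ (G.induce (S \ {x})).Preconnected

/-- `x` is an articulation point of `G`. -/
def IsArticulationPoint (G : SimpleGraph V) (x : V) : Prop :=
  IsArticulationPointOf G Set.univ x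

/-- `G` has a path cover `PC(u, v)`: there are two vertex-disjoint paths, one starting in `u`
and the other one starting in `v`, that together contain all vertices of `G`. -/
def HasPC (G : SimpleGraph V) (u v : V) : Prop :=
  ∃ (a b : V) (p : G.Walk u a) (q : G.Walk v b),
    p.IsPath ∧ q.IsPath ∧ p.support.Disjoint q.support ∧
      ∀ w : V, w ∈ p.support ∨ w ∈ q.support

/-- For every articulation point `x` such that `G - {x}` has at least 3 components, `u` and `v`
are different from `x` and belong to different components of `G - {x}`. -/
def CondA (G : SimpleGraph V) (u v : V) : Prop :=
  ∀ x : V, IsArticulationPoint G x → 3 ≤ numComponents G {x}ᶜ →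
    u ≠ x ∧ v ≠ x ∧ ∀ Q : Set V, IsComponent G {x}ᶜ Q → ¬ (u ∈ Q ∧ v ∈ Q)

/-- For any three articulation points `x, y, z` inducing a triangle: if neither `u` nor `v` is
in `{x, y, z}`, then `u, v` are not in the same component of `G - {x, y, z}`; if exactly one of
them is in `{x, y, z}`, then the other one is not in a component of `G - {x, y, z}` which is
adjacent to it. -/
def CondB (G : SimpleGraph V) (u v : V) : Prop :=
  ∀ x y z : V,
    IsArticulationPoint G x → IsArticulationPoint G y → IsArticulationPoint G z →
    G.Adj x y → G.Adj y z → G.Adj x z →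
    ∀ Q : Set V, IsComponent G ({x, y, z} : Set V)ᶜ Q →
      (u ∉ ({x, y, z} : Set V) → v ∉ ({x, y, z} : Set V) → ¬ (u ∈ Q ∧ v ∈ Q)) ∧
      (u ∈ ({x, y, z} : Set V) → v ∉ ({x, y, z} : Set V) →
        (∃ w ∈ Q, G.Adj u w) → v ∉ Q) ∧
      (v ∈ ({x, y, z} : Set V) → u ∉ ({x, y, z} : Set V) →
        (∃ w ∈ Q, G.Adj v w) → u ∉ Q)

/-- The pair `{u, v}` is not a vertex cut with `c(G - {u, v}) ≥ 3`. -/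
def CondC (G : SimpleGraph V) (u v : V) : Prop :=
  ¬ (¬ (G.induce ({u, v} : Set V)ᶜ).Preconnected ∧ 3 ≤ numComponents G ({u, v} : Set V)ᶜ)

/-- Let `x ≠ u` be an articulation point of `G` with `c(G - {x}) ≤ 2`, let `Q₁` be the component
of `G - {x}` containing `u`, let `y ≠ u` be an articulation point of `G[Q₁]`, and let `J₁` be the
component of `G[Q₁] - {y}` containing `u`. If `v ∈ J₁`, `|J₁| > 2` and all neighbours of `x` in
`Q₁` are in `J₁ ∪ {y}`, then some `x' ∈ J₁` other than `u, v` is adjacent to `x` or `y`. -/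
def CondD (G : SimpleGraph V) (u v : V) : Prop :=
  ∀ x : V, x ≠ u → IsArticulationPoint G x → numComponents G {x}ᶜ ≤ 2 →
    ∀ Q₁ : Set V, IsComponent G {x}ᶜ Q₁ → u ∈ Q₁ →
    ∀ y : V, y ≠ u → IsArticulationPointOf G Q₁ y →
    ∀ J₁ : Set V, IsComponent G (Q₁ \ {y}) J₁ → u ∈ J₁ →
      v ∈ J₁ → 2 < J₁.ncard → (∀ w ∈ Q₁, G.Adj x w → w ∈ J₁ ∪ {y}) →
      ∃ x' ∈ J₁, x' ≠ u ∧ x' ≠ v ∧ (G.Adj x' x ∨ G.Adj x' y)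

end PathCover

/-!
Write `H` for the vertices missed by a pair of disjoint paths from `u` and `v`.

*Necessity.* If a nonempty set `A` contains neither start and its only outside neighbour is `y`,
then a path that enters `A` does so through `y` and cannot leave again, so it ends in `A`
(`Seg.end_mem`, `IsCover.end_mem`). Two paths have only two ends, and only one of them passes
through a given vertex; each of the four conditions excludes a configuration in which more such
traps would be needed.

*Sufficiency for connected graphs.* Take disjoint paths `P` from `u` to `a` and `Q` from `v` to `b`
that cover as many vertices as possible (`MaxPair`), and suppose `H` is not empty. If `a` and `b`
were adjacent, all covered vertices would lie on one path from `u` to `v`, which could be cut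
open next to a neighbour of `H` and extended; so `a`, `b` and any vertex of `H` are independent, and
`H` is a clique. If `w` on `P` has a neighbour in `H`, its successor `t` on `P` is adjacent neither
to `H` nor to `b`. Hence `w` is the only such vertex on `P`: two successors together with `b` and a
vertex of `H` would be independent (`MaxPair.false_of_two_adj`). Moreover the tail `T` of `P` from
`t` to `a` closes up to a cycle, so `b` has no neighbour in it, and therefore `T` is a clique
(`Attached.tail_clique`). The predecessor of `w`, if there is one, is adjacent to `b`
(`Attached.adj_pred`). Three cases remain.

* Both paths meet the neighbourhood of `H`. Then `u` and `v` are the only vertices outside `H` and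
  the two tails, and the graph violates `CondC` or `CondD` (`Attached.false_of_both`).
* Only `P` does, and `w = u`. Then `CondA` or `CondC` is violated, or the path from `v` can absorb
  the tail (`Attached.false_of_init_nil`).
* Only `P` does, and `w ≠ u`. Then the vertices outside `H`, `T` and `w` lie on a path from `u` to
  `v`. Either they are not joined to `T`, against `CondA`, or they form a clique that can be left
  only towards `w` and `t`; two disjoint paths through this clique exist unless `CondB` or `CondD`
  is violated (`Attached.false_of_init_ne_nil`).

*Disconnected graphs.* Each path covers one component. Conversely a component has no three
independent vertices, and a longest path starting at a vertex that is not an articulation point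
is Hamiltonian (`exists_hamiltonian_seg`).

Paths are handled as lists of vertices. That a rearranged pair of paths covers the old vertices and
some new ones is a `List.Perm` statement, proved by counting occurrences.
-/

namespace PathCover

variable {V : Type*} {G : SimpleGraph V}

/-! ### Paths as lists of vertices -/

/-- `Seg G l a b`: consecutive entries of the list `l` are adjacent in `G`, the first entry is `a`
and the last one is `b`. A path of `G` is such a list without repetition; distinctness is kept
apart, so that several paths can be handled by one `Nodup` hypothesis on their concatenation. -/
def Seg (G : SimpleGraph V) (l : List V) (a b : V) : Prop :=
  l.IsChain G.Adj ∧ l.head? = some a ∧ l.getLast? = some b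

namespace Seg

variable {l l₁ l₂ : List V} {a b c d w : V}

theorem single (a : V) : Seg G [a] a a := by simp [Seg]

theorem append (h₁ : Seg G l₁ a b) (h₂ : Seg G l₂ c d) (h : G.Adj b c) :
    Seg G (l₁ ++ l₂) a d := by
  obtain ⟨x₁, y₁, z₁⟩ := h₁
  obtain ⟨x₂, y₂, z₂⟩ := h₂
  refine ⟨List.isChain_append.2 ⟨x₁, x₂, ?_⟩, ?_, ?_⟩
  · simpa [z₁, y₂] using h
  · simp [List.head?_append, y₁]
  · simp [List.getLast?_append, z₂]

theorem cons (h₂ : Seg G l c d) (h : G.Adj b c) : Seg G (b :: l) b d :=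
  (single b).append h₂ h

theorem concat (h₁ : Seg G l a b) (h : G.Adj b c) : Seg G (l ++ [c]) a c :=
  h₁.append (single c) h

theorem reverse (h : Seg G l a b) : Seg G l.reverse b a := by
  obtain ⟨x, y, z⟩ := h
  refine ⟨List.isChain_reverse.2 ?_, by simpa using z, by simpa using y⟩
  exact x.imp fun _ _ h => h.symm

theorem head_mem (h : Seg G l a b) : a ∈ l := List.mem_of_mem_head? (by simp [h.2.1])

theorem last_mem (h : Seg G l a b) : b ∈ l := List.mem_of_mem_getLast? (by simp [h.2.2])

theorem ne_nil (h : Seg G l a b) : l ≠ [] := List.ne_nil_of_mem h.head_mem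

theorem eq_cons (h : Seg G l a b) : ∃ l', l = a :: l' := by
  obtain ⟨_, y, _⟩ := h
  cases l with
  | nil => simp at y
  | cons x l' => exact ⟨l', by simp at y; rw [y]⟩

/-- A nonempty final part of a path, together with the edge leading into it. -/
theorem right_of_append (h : Seg G (l₁ ++ w :: l₂) a b) (h₂ : l₂ ≠ []) :
    ∃ t, Seg G l₂ t b ∧ G.Adj w t := by
  obtain ⟨x, y, z⟩ := h
  have x' := (List.isChain_split.1 x).2
  obtain ⟨t, l₃, rfl⟩ := List.exists_cons_of_ne_nil h₂
  refine ⟨t, ⟨x'.tail, rfl, ?_⟩, x'.rel⟩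
  simpa [List.getLast?_append, List.getLast?_cons_cons] using z

theorem left_of_append (h : Seg G (l₁ ++ w :: l₂) a b) : Seg G (l₁ ++ [w]) a w := by
  obtain ⟨x, y, z⟩ := h
  refine ⟨(List.isChain_split.1 x).1, ?_, by simp⟩
  cases l₁ <;> simpa using y

/-- A nonempty initial part of a path, together with the edge leaving it. -/
theorem init_of_append (h : Seg G (l₁ ++ w :: l₂) a b) (h₁ : l₁ ≠ []) :
    ∃ m, Seg G l₁ a m ∧ G.Adj m w := by
  have := h.reverse
  simp only [List.reverse_append, List.reverse_cons, List.append_assoc, List.singleton_append]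
    at this
  obtain ⟨m, hm, hw⟩ := this.right_of_append (by simpa using h₁)
  exact ⟨m, by simpa using hm.reverse, hw.symm⟩

theorem eq_of_nil_append (h : Seg G ([] ++ w :: l₂) a b) : w = a := by
  simpa using h.2.1

theorem eq_of_append_nil (h : Seg G (l₁ ++ [w]) a b) : w = b := by
  simpa using h.2.2

/-- A path whose last vertex is adjacent to the last vertex of a second path can be continued
backwards along any final part of the second path. -/
theorem append_reverse_tail (h : Seg G l c d) (h' : Seg G (l₁ ++ w :: l₂) a b) (hbd : G.Adj d b) :
    ∃ e, Seg G (l ++ l₂.reverse) c e := by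
  rcases eq_or_ne l₂ [] with rfl | h₂
  · exact ⟨d, by simpa using h⟩
  · obtain ⟨t, ht, -⟩ := h'.right_of_append h₂
    exact ⟨t, h.append ht.reverse hbd⟩

theorem eq_singleton (h : Seg G l a a) (hl : l.Nodup) : l = [a] := by
  obtain ⟨l', rfl⟩ := h.eq_cons
  cases l' with
  | nil => rfl
  | cons x l'' =>
    have : a ∈ x :: l'' := by
      have := h.2.2
      rw [List.getLast?_cons_cons] at this
      exact List.mem_of_mem_getLast? (by simp [this])
    exact absurd this (List.nodup_cons.1 hl).1

end Seg

/-- In a clique any two vertices are joined by a path through the whole clique. -/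
theorem exists_seg_perm_of_clique {K : List V} (hK : K.Nodup)
    (hadj : ∀ x ∈ K, ∀ y ∈ K, x ≠ y → G.Adj x y) {a b : V} (ha : a ∈ K) (hb : b ∈ K)
    (hab : a ≠ b) : ∃ l, l.Perm K ∧ Seg G l a b := by
  classical
  have hp : (a :: ((K.erase a).erase b ++ [b])).Perm K := by
    have h1 := List.perm_cons_erase ha
    have h2 := List.perm_cons_erase ((List.mem_erase_of_ne hab.symm).2 hb)
    refine (List.Perm.cons a ?_).trans h1.symm
    exact (List.perm_append_singleton _ _).trans h2.symm
  refine ⟨_, hp, ?_, by simp, ?_⟩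
  · refine List.Pairwise.isChain ?_
    have hn := hp.nodup_iff.2 hK
    refine List.Pairwise.imp_of_mem ?_ hn
    intro x y hx hy hxy
    exact hadj x (hp.mem_iff.1 hx) y (hp.mem_iff.1 hy) hxy
  · rw [← List.cons_append, List.getLast?_append]
    rfl

theorem hasPC_iff {u v : V} : HasPC G u v ↔
    ∃ P Q a b, Seg G P u a ∧ Seg G Q v b ∧ (P ++ Q).Nodup ∧ ∀ w, w ∈ P ∨ w ∈ Q := by
  constructor
  · rintro ⟨a, b, p, q, hp, hq, hd, hc⟩
    refine ⟨p.support, q.support, a, b, ⟨p.isChain_adj_support, ?_, ?_⟩,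
      ⟨q.isChain_adj_support, ?_, ?_⟩, ?_, hc⟩
    · rw [← p.cons_tail_support]; rfl
    · rw [List.getLast?_eq_some_getLast p.support_ne_nil, p.getLast_support]
    · rw [← q.cons_tail_support]; rfl
    · rw [List.getLast?_eq_some_getLast q.support_ne_nil, q.getLast_support]
    · exact List.nodup_append'.2 ⟨hp.support_nodup, hq.support_nodup, hd⟩
  · rintro ⟨P, Q, a, b, hP, hQ, hn, hc⟩
    have key : ∀ {l : List V} {x y : V}, Seg G l x y → ∃ p : G.Walk x y, p.support = l := by
      intro l x y h
      have hl := h.ne_nil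
      have h1 : l.head hl = x := by
        have := h.2.1; rw [List.head?_eq_some_head hl] at this; simpa using this
      have h2 : l.getLast hl = y := by
        have := h.2.2; rw [List.getLast?_eq_some_getLast hl] at this; simpa using this
      subst h1 h2
      exact ⟨Walk.ofSupport l hl h.1, Walk.support_ofSupport hl h.1⟩
    obtain ⟨p, rfl⟩ := key hP
    obtain ⟨q, rfl⟩ := key hQ
    obtain ⟨h1, h2, h3⟩ := List.nodup_append'.1 hn
    exact ⟨a, b, p, q, ⟨p.isPath_def.2 h1, q.isPath_def.2 h2, h3, hc⟩⟩

/-! ### Connectivity in terms of closed sets -/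

/-- `A ⊆ S` is closed in `G[S]` if no edge of `G[S]` leaves `A`, i.e. `A` is a union of components
of `G[S]`. Connectivity is expressed through such sets throughout. -/
def ClosedIn (G : SimpleGraph V) (S A : Set V) : Prop :=
  A ⊆ S ∧ ∀ a ∈ A, ∀ b ∈ S, G.Adj a b → b ∈ A

/-- `b` lies in the component of `a` in `G[S]`: it belongs to every closed set containing `a`. -/
def Linked (G : SimpleGraph V) (S : Set V) (a b : V) : Prop :=
  ∀ A, ClosedIn G S A → a ∈ A → b ∈ A

variable {S A B C Q : Set V} {a b c x y : V}

theorem Linked.refl (a : V) : Linked G S a a := fun _ _ h => h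

theorem Linked.trans (h₁ : Linked G S a b) (h₂ : Linked G S b c) : Linked G S a c :=
  fun A hA h => h₂ A hA (h₁ A hA h)

theorem Linked.of_adj (h : G.Adj a b) (hb : b ∈ S) : Linked G S a b :=
  fun _ hA ha => hA.2 a ha b hb h

theorem Linked.of_seg {l : List V} : ∀ {a b : V}, Seg G l a b → (∀ x ∈ l, x ∈ S) →
    ∀ c ∈ l, Linked G S a c := by
  induction l with
  | nil => simp
  | cons z l ih =>
    intro a b h hl c hc
    have hz : z = a := Seg.eq_of_nil_append h
    subst hz
    rcases List.mem_cons.1 hc with rfl | hc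
    · exact .refl _
    · obtain ⟨t, ht, hadj⟩ := Seg.right_of_append (l₁ := []) h (List.ne_nil_of_mem hc)
      exact (Linked.of_adj hadj (hl _ (List.mem_cons_of_mem _ ht.head_mem))).trans
        (ih ht (fun x hx => hl x (List.mem_cons_of_mem _ hx)) c hc)

theorem ClosedIn.diff (hA : ClosedIn G S A) : ClosedIn G S (S \ A) :=
  ⟨Set.sdiff_subset, fun a ha b hb hab => ⟨hb, fun h => ha.2 (hA.2 b h a ha.1 hab.symm)⟩⟩

theorem Linked.symm (h : Linked G S a b) (ha : a ∈ S) : Linked G S b a := by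
  intro A hA hb
  by_contra h'
  exact (h _ hA.diff ⟨ha, h'⟩).2 hb

theorem ClosedIn.mem_of_reachable (hA : ClosedIn G S A) {a b : S}
    (h : (G.induce S).Reachable a b) (ha : (a : V) ∈ A) : (b : V) ∈ A := by
  obtain ⟨p⟩ := h
  induction p with
  | nil => exact ha
  | @cons x y z hxy _ ih => exact ih (hA.2 _ ha _ y.2 hxy)

theorem closedIn_reachable (G : SimpleGraph V) (a : S) :
    ClosedIn G S {b | ∃ h : b ∈ S, (G.induce S).Reachable a ⟨b, h⟩} := by
  refine ⟨fun b hb => hb.1, ?_⟩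
  rintro b ⟨hb, hr⟩ c hc hbc
  exact ⟨hc, hr.trans (Adj.reachable (by simpa using hbc))⟩

theorem reachable_iff_linked {a b : S} : (G.induce S).Reachable a b ↔ Linked G S a b := by
  constructor
  · exact fun h A hA ha => hA.mem_of_reachable h ha
  · intro h
    exact (h _ (closedIn_reachable G a) ⟨a.2, .refl _⟩).2

theorem not_preconnected_of_closedIn (hA : ClosedIn G S A) (ha : a ∈ A) (hb : b ∈ S)
    (hb' : b ∉ A) : ¬ (G.induce S).Preconnected :=
  fun h => hb' (hA.mem_of_reachable (h ⟨a, hA.1 ha⟩ ⟨b, hb⟩) ha)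

theorem exists_closedIn_of_not_preconnected (h : ¬ (G.induce S).Preconnected) (hy : y ∈ S) :
    ∃ A, ClosedIn G S A ∧ A.Nonempty ∧ y ∉ A := by
  by_contra! hc
  refine h fun a b => ?_
  have key : ∀ a : S, (G.induce S).Reachable ⟨y, hy⟩ a := by
    intro a
    refine reachable_iff_linked.2 fun A hA hyA => ?_
    by_contra ha
    exact hc _ hA.diff ⟨a, a.2, ha⟩ |>.2 hyA
  exact (key a).symm.trans (key b)

theorem IsComponent.closedIn (hQ : IsComponent G S Q) : ClosedIn G S Q := by
  obtain ⟨C, rfl⟩ := hQ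
  refine ⟨fun b ⟨b', _, h⟩ => h ▸ b'.2, ?_⟩
  rintro _ ⟨a, ha, rfl⟩ b hb hab
  refine ⟨⟨b, hb⟩, ?_, rfl⟩
  exact C.mem_supp_of_adj_mem_supp ha (by simpa using hab)

theorem IsComponent.nonempty (hQ : IsComponent G S Q) : Q.Nonempty := by
  obtain ⟨C, rfl⟩ := hQ
  exact C.nonempty_supp.image _

theorem IsComponent.linked (hQ : IsComponent G S Q) (ha : a ∈ Q) (hb : b ∈ Q) :
    Linked G S a b := by
  obtain ⟨C, rfl⟩ := hQ
  obtain ⟨a, ha, rfl⟩ := ha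
  obtain ⟨b, hb, rfl⟩ := hb
  exact reachable_iff_linked.1 (C.reachable_of_mem_supp ha hb)

theorem exists_isComponent (G : SimpleGraph V) (ha : a ∈ S) : ∃ Q, IsComponent G S Q ∧ a ∈ Q :=
  ⟨_, ⟨(G.induce S).connectedComponentMk ⟨a, ha⟩, rfl⟩, ⟨a, ha⟩, rfl, rfl⟩

theorem IsComponent.eq_of_linked (hQ : IsComponent G S Q) (hA : ClosedIn G S A) (ha : a ∈ Q)
    (haA : a ∈ A) (h : ∀ b ∈ A, Linked G S a b) : Q = A :=
  Set.Subset.antisymm (fun _ hb => hQ.linked ha hb _ hA haA)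
    (fun b hb => h b hb _ hQ.closedIn ha)

theorem isComponent_of_linked (hA : ClosedIn G S A) (haA : a ∈ A)
    (h : ∀ b ∈ A, Linked G S a b) : IsComponent G S A := by
  obtain ⟨Q, hQ, ha⟩ := exists_isComponent G (hA.1 haA)
  rwa [← hQ.eq_of_linked hA ha haA h]

theorem three_le_numComponents [Finite V] (hA : ClosedIn G S A) (hB : ClosedIn G S B)
    (hC : ClosedIn G S C) (nA : A.Nonempty) (nB : B.Nonempty) (nC : C.Nonempty)
    (hAB : Disjoint A B) (hAC : Disjoint A C) (hBC : Disjoint B C) : 3 ≤ numComponents G S := by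
  obtain ⟨a, ha⟩ := nA
  obtain ⟨b, hb⟩ := nB
  obtain ⟨c, hc⟩ := nC
  have key : ∀ {A B : Set V} {a b : V} (hA : ClosedIn G S A) (hB : ClosedIn G S B)
      (_ : Disjoint A B) (ha : a ∈ A) (hb : b ∈ B),
      (G.induce S).connectedComponentMk ⟨a, hA.1 ha⟩ ≠
        (G.induce S).connectedComponentMk ⟨b, hB.1 hb⟩ := by
    intro A B a b hA hB hd ha hb h
    exact Set.disjoint_left.1 hd (hA.mem_of_reachable (ConnectedComponent.exact h) ha) hb
  have := Fintype.ofFinite (G.induce S).ConnectedComponent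
  rw [numComponents, Nat.card_eq_fintype_card]
  exact Fintype.two_lt_card_iff.2 ⟨_, _, _, key hA hB hAB ha hb, key hA hC hAC ha hc,
    key hB hC hBC hb hc⟩

theorem exists_two_isComponent [Finite V] (h : 3 ≤ numComponents G S) (hQ : IsComponent G S Q) :
    ∃ A B, IsComponent G S A ∧ IsComponent G S B ∧ Disjoint A B ∧ Disjoint Q A ∧
      Disjoint Q B := by
  classical
  have := Fintype.ofFinite (G.induce S).ConnectedComponent
  rw [numComponents, Nat.card_eq_fintype_card] at h
  obtain ⟨c, rfl⟩ := hQ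
  have h1 : 1 < ((Finset.univ : Finset (G.induce S).ConnectedComponent).erase c).card := by
    rw [Finset.card_erase_of_mem (Finset.mem_univ _), Finset.card_univ]; omega
  obtain ⟨a, ha, b, hb, hab⟩ := Finset.one_lt_card.1 h1
  have key : ∀ {a b : (G.induce S).ConnectedComponent}, a ≠ b →
      Disjoint (Subtype.val '' a.supp) (Subtype.val '' b.supp) := fun h =>
    (Set.disjoint_image_iff Subtype.val_injective).2
      ((G.induce S).pairwise_disjoint_supp_connectedComponent h)
  exact ⟨_, _, ⟨a, rfl⟩, ⟨b, rfl⟩, key hab, key (Finset.ne_of_mem_erase ha).symm,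
    key (Finset.ne_of_mem_erase hb).symm⟩

/-! ### Necessity of the conditions -/

section Necessity

variable {S S' A B C : Set V} {x y z u v e f : V} {l P Q : List V}

theorem ClosedIn.mono (hA : ClosedIn G S A) (hS : S' ⊆ S) (hAS : A ⊆ S') : ClosedIn G S' A :=
  ⟨hAS, fun a ha b hb => hA.2 a ha b (hS hb)⟩

theorem isArticulationPoint_iff :
    IsArticulationPoint G x ↔ ¬ (G.induce ({x} : Set V)ᶜ).Preconnected := by
  rw [IsArticulationPoint, IsArticulationPointOf, ← Set.compl_eq_univ_sdiff]
  simp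

/-- A path starting outside `A` that meets `A`, and can cross the boundary of `A` only through
`y`, passes through `y` and then ends in `A`. -/
theorem Seg.end_mem (h : Seg G l u e) (hl : l.Nodup) (hu : u ∉ A)
    (hA : ∀ a ∈ l, ∀ b ∈ l, a ∈ A → b ∉ A → G.Adj a b → b = y) (hc : ∃ c ∈ l, c ∈ A) :
    y ∈ l ∧ e ∈ A := by
  induction l generalizing u with
  | nil => simp at hc
  | cons s l ih =>
    obtain rfl : s = u := Seg.eq_of_nil_append h
    obtain ⟨c, hc, hcA⟩ := hc
    have hcl : c ∈ l := (List.mem_cons.1 hc).resolve_left fun h => hu (h ▸ hcA)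
    obtain ⟨t, ht, hst⟩ := Seg.right_of_append (l₁ := []) h (List.ne_nil_of_mem hcl)
    have hl' := List.nodup_cons.1 hl
    by_cases htA : t ∈ A
    · have hy := hA t (List.mem_cons_of_mem _ ht.head_mem) s (by simp) htA hu hst.symm
      refine ⟨by simp [hy], ?_⟩
      have hcl : ClosedIn G {x | x ∈ l} ({x | x ∈ l} ∩ A) := by
        refine ⟨Set.inter_subset_left, fun a ha b hb hab => ⟨hb, ?_⟩⟩
        by_contra hbA
        have := hA a (List.mem_cons_of_mem _ ha.1) b (List.mem_cons_of_mem _ hb) ha.2 hbA hab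
        exact hl'.1 (hy ▸ this ▸ hb)
      exact (Linked.of_seg ht (fun _ h => h) e ht.last_mem _ hcl ⟨ht.head_mem, htA⟩).2
    · obtain ⟨h1, h2⟩ := ih ht hl'.2 htA (fun a ha b hb => hA a (List.mem_cons_of_mem _ ha) b
        (List.mem_cons_of_mem _ hb)) ⟨c, hcl, hcA⟩
      exact ⟨List.mem_cons_of_mem _ h1, h2⟩

theorem Seg.mem_of_exit (h : Seg G l u e) (hu : u ∈ A) (he : e ∉ A)
    (hA : ClosedIn G {x}ᶜ A) : x ∈ l := by
  by_contra hx
  have hcl : ClosedIn G {x | x ∈ l} ({x | x ∈ l} ∩ A) := by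
    refine ⟨Set.inter_subset_left, fun a ha b hb hab => ⟨hb, hA.2 a ha.2 b ?_ hab⟩⟩
    rintro rfl
    exact hx hb
  exact he (Linked.of_seg h (fun _ h => h) e h.last_mem _ hcl ⟨h.head_mem, hu⟩).2

/-- Two disjoint paths, given by their vertex lists, that start in `u` and `v`, end in `e` and `f`
and together contain all vertices. -/
structure IsCover (G : SimpleGraph V) (u v : V) (P Q : List V) (e f : V) : Prop where
  left : Seg G P u e
  right : Seg G Q v f
  nodup : (P ++ Q).Nodup
  cover : ∀ w, w ∈ P ∨ w ∈ Q

namespace IsCover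

theorem symm (h : IsCover G u v P Q e f) : IsCover G v u Q P f e :=
  ⟨h.right, h.left, (List.perm_append_comm.nodup_iff).1 h.nodup, fun w => (h.cover w).symm⟩

theorem not_mem_right (h : IsCover G u v P Q e f) (hx : x ∈ P) : x ∉ Q :=
  fun hx' => (List.disjoint_of_nodup_append h.nodup) hx hx'

theorem not_mem_left (h : IsCover G u v P Q e f) (hx : x ∈ Q) : x ∉ P :=
  fun hx' => h.not_mem_right hx' hx

/-- A nonempty set that contains neither start and can only be entered through `y` contains an end
of the path through `y`. -/
theorem end_mem (h : IsCover G u v P Q e f) (hA : ClosedIn G {y}ᶜ A) (hne : A.Nonempty)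
    (hu : u ∉ A) (hv : v ∉ A) : (y ∈ P ∧ e ∈ A) ∨ (y ∈ Q ∧ f ∈ A) := by
  have hb : ∀ {a b}, a ∈ A → b ∉ A → G.Adj a b → b = y := by
    intro a b ha hb hab
    by_contra hby
    exact hb (hA.2 a ha b hby hab)
  obtain ⟨c, hc⟩ := hne
  rcases h.cover c with hcP | hcQ
  · exact .inl (h.left.end_mem (List.Nodup.of_append_left h.nodup) hu
      (fun a _ b _ => hb) ⟨c, hcP, hc⟩)
  · exact .inr (h.right.end_mem (List.Nodup.of_append_right h.nodup) hv
      (fun a _ b _ => hb) ⟨c, hcQ, hc⟩)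

theorem false_of_two_closedIn (h : IsCover G u v P Q e f) (hA : ClosedIn G {y}ᶜ A)
    (hB : ClosedIn G {y}ᶜ B) (nA : A.Nonempty) (nB : B.Nonempty) (hAB : Disjoint A B)
    (huA : u ∉ A) (hvA : v ∉ A) (huB : u ∉ B) (hvB : v ∉ B) : False := by
  rcases h.end_mem hA nA huA hvA with ⟨h1, h2⟩ | ⟨h1, h2⟩ <;>
  rcases h.end_mem hB nB huB hvB with ⟨h3, h4⟩ | ⟨h3, h4⟩
  · exact Set.disjoint_left.1 hAB h2 h4
  · exact h.not_mem_right h1 h3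
  · exact h.not_mem_right h3 h1
  · exact Set.disjoint_left.1 hAB h2 h4

theorem condA [Finite V] (h : IsCover G u v P Q e f) (huv : u ≠ v) : CondA G u v := by
  intro x _ hx
  have key : ∀ K, IsComponent G {x}ᶜ K → (u ∈ K ∨ u = x) → (v ∈ K ∨ v = x) → False := by
    intro K hK hu hv
    obtain ⟨A, B, hA, hB, hAB, hKA, hKB⟩ := exists_two_isComponent hx hK
    have h1 : ∀ {D : Set V} {w}, IsComponent G {x}ᶜ D → Disjoint K D → (w ∈ K ∨ w = x) →
        w ∉ D := by
      rintro D w hD hd (hw | rfl) hwD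
      · exact Set.disjoint_left.1 hd hw hwD
      · exact hD.closedIn.1 hwD rfl
    exact h.false_of_two_closedIn hA.closedIn hB.closedIn hA.nonempty hB.nonempty hAB
      (h1 hA hKA hu) (h1 hA hKA hv) (h1 hB hKB hu) (h1 hB hKB hv)
  refine ⟨?_, ?_, fun K hK hm => key K hK (.inl hm.1) (.inl hm.2)⟩
  · rintro rfl
    obtain ⟨K, hK, hv⟩ := exists_isComponent G (S := ({u} : Set V)ᶜ) (a := v) huv.symm
    exact key K hK (.inr rfl) (.inl hv)
  · rintro rfl
    obtain ⟨K, hK, hu⟩ := exists_isComponent G (S := ({v} : Set V)ᶜ) (a := u) huv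
    exact key K hK (.inl hu) (.inr rfl)

theorem condC [Finite V] (h : IsCover G u v P Q e f) : CondC G u v := by
  rintro ⟨-, h3⟩
  have hne : (({u, v} : Set V)ᶜ).Nonempty := by
    by_contra hc
    rw [Set.not_nonempty_iff_eq_empty] at hc
    have : IsEmpty ↥(({u, v} : Set V)ᶜ) := by rw [hc]; infer_instance
    have : IsEmpty (G.induce ({u, v} : Set V)ᶜ).ConnectedComponent :=
      ⟨fun c => by obtain ⟨x, _⟩ := c.nonempty_supp; exact isEmptyElim x⟩
    rw [numComponents, Nat.card_of_isEmpty] at h3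
    omega
  obtain ⟨c, hc⟩ := hne
  obtain ⟨K, hK, _⟩ := exists_isComponent G hc
  obtain ⟨A, B, hA, hB, hAB, hKA, hKB⟩ := exists_two_isComponent h3 hK
  have key : ∀ {D : Set V}, IsComponent G ({u, v} : Set V)ᶜ D → e ∈ D ∨ f ∈ D := by
    intro D hD
    have hb : ∀ {a b}, a ∈ D → b ∉ D → G.Adj a b → b = u ∨ b = v := by
      intro a b ha hb hab
      by_contra hby
      exact hb (hD.closedIn.2 a ha b hby hab)
    have hu : u ∉ D := fun hu => hD.closedIn.1 hu (by simp)
    have hv : v ∉ D := fun hv => hD.closedIn.1 hv (by simp)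
    obtain ⟨c, hc⟩ := hD.nonempty
    rcases h.cover c with hcP | hcQ
    · refine .inl (h.left.end_mem (y := u) (List.Nodup.of_append_left h.nodup) hu ?_
        ⟨c, hcP, hc⟩).2
      intro a _ b hbP ha hbD hab
      exact (hb ha hbD hab).resolve_right fun hbv =>
        h.not_mem_right hbP (hbv ▸ h.right.head_mem)
    · refine .inr (h.right.end_mem (y := v) (List.Nodup.of_append_right h.nodup) hv ?_
        ⟨c, hcQ, hc⟩).2
      intro a _ b hbP ha hbD hab
      exact (hb ha hbD hab).resolve_left fun hbv =>
        h.not_mem_left hbP (hbv ▸ h.left.head_mem)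
  rcases key hA with h1 | h1 <;> rcases key hB with h2 | h2 <;> rcases key hK with h4 | h4 <;>
    first
    | exact Set.disjoint_left.1 hAB h1 h2
    | exact Set.disjoint_left.1 hKA h4 h1
    | exact Set.disjoint_left.1 hKB h4 h2

theorem condD (h : IsCover G u v P Q e f) : CondD G u v := by
  intro x hxu hx _ Q₁ hQ₁ huQ y hyu hy J₁ hJ₁ huJ hvJ hcard hnb
  by_contra! hcon
  have hJQ : J₁ ⊆ Q₁ := fun a ha => (hJ₁.closedIn.1 ha).1
  obtain ⟨A, hA, nA, huA⟩ := exists_closedIn_of_not_preconnected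
    (isArticulationPoint_iff.1 hx) (y := u) hxu.symm
  have dA : ∀ a ∈ Q₁, a ∉ A := fun a ha haA => huA (hQ₁.linked ha huQ _ hA haA)
  obtain ⟨B, hB, nB, huB⟩ := exists_closedIn_of_not_preconnected hy.2 (y := u) ⟨huQ, hyu.symm⟩
  have dB : ∀ a ∈ J₁, a ∉ B := fun a ha haB => huB (hJ₁.linked ha huJ _ hB haB)
  have hB' : ClosedIn G {y}ᶜ B := by
    refine ⟨fun b hb => (hB.1 hb).2, fun b hb c hc hbc => ?_⟩
    have hbQ := (hB.1 hb)
    by_cases hcx : c = x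
    · subst hcx
      rcases hnb b hbQ.1 hbc.symm with hbJ | hby
      · exact absurd hb (dB b hbJ)
      · exact absurd hby hbQ.2
    · exact hB.2 b hb c ⟨hQ₁.closedIn.2 b hbQ.1 c hcx hbc, hc⟩ hbc
  have h1 := h.end_mem hA nA huA (dA v (hJQ hvJ))
  have h2 := h.end_mem hB' nB huB (dB v hvJ)
  have hAB : ∀ a ∈ A, a ∉ B := fun a ha hb => dA a (hB.1 hb).1 ha
  -- a third vertex of `J₁` is trapped behind `u` and `v`
  obtain ⟨c, hc, hcuv⟩ : ∃ c ∈ J₁, c ∉ ({u, v} : Set V) := by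
    by_contra! hsub
    have := Set.ncard_le_ncard (s := J₁) (t := {u, v}) hsub (Set.toFinite _)
    have := (Set.ncard_insert_le u {v}).trans_eq (by rw [Set.ncard_singleton])
    omega
  have hb : ∀ {a b}, a ∈ J₁ \ {u, v} → b ∉ J₁ \ {u, v} → G.Adj a b → b = u ∨ b = v := by
    intro a b ha hb hab
    by_contra hbuv
    have ha' := ha.2
    simp only [Set.mem_insert_iff, Set.mem_singleton_iff, not_or] at ha'
    have hax := hcon a ha.1 ha'.1 ha'.2
    refine hb ⟨hJ₁.closedIn.2 a ha.1 b ⟨hQ₁.closedIn.2 a (hJQ ha.1) b ?_ hab, ?_⟩ hab, hbuv⟩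
    · rintro rfl; exact hax.1 hab
    · rintro rfl; exact hax.2 hab
  rcases h.cover c with hcP | hcQ
  · have h3 := (h.left.end_mem (A := J₁ \ {u, v}) (y := u) (List.Nodup.of_append_left h.nodup)
      (by simp) (fun a _ b hbP ha hbD hab => (hb ha hbD hab).resolve_right fun hbv =>
        h.not_mem_right hbP (hbv ▸ h.right.head_mem)) ⟨c, hcP, hc, hcuv⟩).2
    rcases h1 with ⟨_, h1⟩ | ⟨_, h1⟩
    · exact dA e (hJQ h3.1) h1
    · rcases h2 with ⟨_, h2⟩ | ⟨_, h2⟩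
      · exact dB e h3.1 h2
      · exact hAB f h1 h2
  · have h3 := (h.right.end_mem (A := J₁ \ {u, v}) (y := v) (List.Nodup.of_append_right h.nodup)
      (by simp) (fun a _ b hbP ha hbD hab => (hb ha hbD hab).resolve_left fun hbv =>
        h.not_mem_left hbP (hbv ▸ h.left.head_mem)) ⟨c, hcQ, hc, hcuv⟩).2
    rcases h1 with ⟨_, h1⟩ | ⟨_, h1⟩
    · rcases h2 with ⟨_, h2⟩ | ⟨_, h2⟩
      · exact hAB e h1 h2
      · exact dB f h3.1 h2
    · exact dA f (hJQ h3.1) h1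

/-- Both ends lie in sets `B`, `C` outside `A`, so both paths leave `A` through `x`. -/
theorem false_of_starts_mem (h : IsCover G u v P Q e f) (hA : ClosedIn G {x}ᶜ A)
    (hB : ClosedIn G {y}ᶜ B) (hC : ClosedIn G {z}ᶜ C) (nB : B.Nonempty) (nC : C.Nonempty)
    (hAB : Disjoint A B) (hAC : Disjoint A C) (hBC : Disjoint B C) (hxB : x ∉ B) (hxC : x ∉ C)
    (hu : u ∈ A ∨ u = x) (hv : v ∈ A ∨ v = x) : False := by
  have hB' : ∀ {w}, (w ∈ A ∨ w = x) → w ∉ B := by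
    rintro w (hw | rfl)
    exacts [Set.disjoint_left.1 hAB hw, hxB]
  have hC' : ∀ {w}, (w ∈ A ∨ w = x) → w ∉ C := by
    rintro w (hw | rfl)
    exacts [Set.disjoint_left.1 hAC hw, hxC]
  have he : e ∉ A ∧ f ∉ A := by
    rcases h.end_mem hB nB (hB' hu) (hB' hv) with ⟨_, h1⟩ | ⟨_, h1⟩ <;>
    rcases h.end_mem hC nC (hC' hu) (hC' hv) with ⟨_, h2⟩ | ⟨_, h2⟩
    · exact absurd h2 (Set.disjoint_left.1 hBC h1)
    · exact ⟨Set.disjoint_right.1 hAB h1, Set.disjoint_right.1 hAC h2⟩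
    · exact ⟨Set.disjoint_right.1 hAC h2, Set.disjoint_right.1 hAB h1⟩
    · exact absurd h2 (Set.disjoint_left.1 hBC h1)
  have h1 : x ∈ P := by
    rcases hu with hu | rfl
    exacts [h.left.mem_of_exit hu he.1 hA, h.left.head_mem]
  have h2 : x ∈ Q := by
    rcases hv with hv | rfl
    exacts [h.right.mem_of_exit hv he.2 hA, h.right.head_mem]
  exact h.not_mem_right h1 h2

theorem false_of_three_closedIn (h : IsCover G u v P Q e f) (hA : ClosedIn G {x}ᶜ A)
    (hB : ClosedIn G {y}ᶜ B) (hC : ClosedIn G {z}ᶜ C) (nA : A.Nonempty) (nB : B.Nonempty)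
    (nC : C.Nonempty) (hAB : Disjoint A B) (hAC : Disjoint A C) (hBC : Disjoint B C)
    (huA : u ∉ A) (hvA : v ∉ A) (huB : u ∉ B) (hvB : v ∉ B) (huC : u ∉ C) (hvC : v ∉ C) :
    False := by
  rcases h.end_mem hA nA huA hvA with ⟨_, h1⟩ | ⟨_, h1⟩ <;>
  rcases h.end_mem hB nB huB hvB with ⟨_, h2⟩ | ⟨_, h2⟩ <;>
  rcases h.end_mem hC nC huC hvC with ⟨_, h3⟩ | ⟨_, h3⟩ <;>
  first
  | exact Set.disjoint_left.1 hAB h1 h2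
  | exact Set.disjoint_left.1 hAC h1 h3
  | exact Set.disjoint_left.1 hBC h2 h3

end IsCover

/-- An articulation point `x` cuts off a part of the graph avoiding any two adjacent vertices `y`,
`z` of which `y` is adjacent to `x`. -/
theorem IsArticulationPoint.exists_closedIn (hx : IsArticulationPoint G x) (hxy : G.Adj x y)
    (hyz : G.Adj y z) :
    ∃ A, ClosedIn G {x}ᶜ A ∧ A.Nonempty ∧ y ∉ A ∧ z ∉ A := by
  obtain ⟨A, hA, nA, hyA⟩ := exists_closedIn_of_not_preconnected
    (isArticulationPoint_iff.1 hx) (y := y) hxy.ne'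
  exact ⟨A, hA, nA, hyA, fun hz => hyA (hA.2 z hz y hxy.ne' hyz.symm)⟩

/-- Parts cut off by different articulation points do not meet, as `G` is connected. -/
theorem ClosedIn.disjoint (hG : G.Preconnected) (hA : ClosedIn G {x}ᶜ A)
    (hB : ClosedIn G {y}ᶜ B) (hxy : x ≠ y) (hyA : y ∉ A) (hxB : x ∉ B) : Disjoint A B := by
  rw [Set.disjoint_left]
  intro a ha hb
  have hcl : ∀ a ∈ A ∩ B, ∀ b, G.Adj a b → b ∈ A ∩ B := by
    rintro a ⟨ha, hb⟩ b hab
    have h1 : b ≠ x := by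
      rintro rfl
      exact hxB (hB.2 a hb b hxy hab)
    have h2 : b ≠ y := by
      rintro rfl
      exact hyA (hA.2 a ha b hxy.symm hab)
    exact ⟨hA.2 a ha b h1 hab, hB.2 a hb b h2 hab⟩
  have : ∀ {c d} (_ : G.Walk c d), c ∈ A ∩ B → d ∈ A ∩ B := by
    intro c d p
    induction p with
    | nil => exact id
    | cons hcd _ ih => exact fun hc => ih (hcl _ hc _ hcd)
  obtain ⟨p⟩ := hG a x
  exact hA.1 (this p ⟨ha, hb⟩).1 rfl

theorem IsCover.condB (h : IsCover G u v P Q e f) (hG : G.Preconnected) : CondB G u v := by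
  intro x y z hx hy hz hxy hyz hxz K hK
  obtain ⟨A, hA, nA, hyA, hzA⟩ := hx.exists_closedIn hxy hyz
  obtain ⟨B, hB, nB, hzB, hxB⟩ := hy.exists_closedIn hyz hxz.symm
  obtain ⟨C, hC, nC, hxC, hyC⟩ := hz.exists_closedIn hxz.symm hxy
  have hAB := hA.disjoint hG hB hxy.ne hyA hxB
  have hAC := hA.disjoint hG hC hxz.ne hzA hxC
  have hBC := hB.disjoint hG hC hyz.ne hzB hyC
  have hxA : x ∉ A := fun h => hA.1 h rfl
  have hyB : y ∉ B := fun h => hB.1 h rfl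
  have hzC : z ∉ C := fun h => hC.1 h rfl
  have lift : ∀ {D : Set V} {t}, ClosedIn G {t}ᶜ D → t ∈ ({x, y, z} : Set V) → x ∉ D → y ∉ D →
      z ∉ D → ∀ {a b}, a ∈ K → b ∈ K → a ∈ D → b ∈ D := by
    intro D t hD ht h1 h2 h3 a b ha hb
    refine hK.linked ha hb D (hD.mono ?_ ?_)
    · intro c hc hct
      rw [Set.mem_singleton_iff] at hct
      exact hc (hct ▸ ht)
    · rintro c hc (rfl | rfl | rfl)
      exacts [h1 hc, h2 hc, h3 hc]
  have lA := fun {a b} => lift hA (by simp) hxA hyA hzA (a := a) (b := b)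
  have lB := fun {a b} => lift hB (by simp) hxB hyB hzB (a := a) (b := b)
  have lC := fun {a b} => lift hC (by simp) hxC hyC hzC (a := a) (b := b)
  -- one start in the triangle, the other one in an adjacent component
  have key : ∀ {u v e f : V} {P Q : List V}, IsCover G u v P Q e f → u ∈ ({x, y, z} : Set V) →
      (∃ w ∈ K, G.Adj u w) → v ∉ K := by
    rintro u v e f P Q h hu ⟨w, hw, huw⟩ hv
    have out : ∀ {D : Set V} {t}, ClosedIn G {t}ᶜ D → u ≠ t → u ∉ D → w ∉ D :=
      fun hD hut huD hwD => huD (hD.2 w hwD u hut huw.symm)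
    rcases hu with rfl | rfl | rfl
    · by_cases hvA : v ∈ A
      · exact h.false_of_starts_mem hA hB hC nB nC hAB hAC hBC hxB hxC (.inr rfl) (.inl hvA)
      · exact h.false_of_three_closedIn hA hB hC nA nB nC hAB hAC hBC hxA hvA hxB
          (fun hvB => out hB hxy.ne hxB (lB hv hw hvB)) hxC
          (fun hvC => out hC hxz.ne hxC (lC hv hw hvC))
    · by_cases hvB : v ∈ B
      · exact h.false_of_starts_mem hB hA hC nA nC hAB.symm hBC hAC hyA hyC (.inr rfl) (.inl hvB)
      · exact h.false_of_three_closedIn hA hB hC nA nB nC hAB hAC hBC hyA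
          (fun hvA => out hA hxy.ne' hyA (lA hv hw hvA)) hyB hvB hyC
          (fun hvC => out hC hyz.ne hyC (lC hv hw hvC))
    · by_cases hvC : v ∈ C
      · exact h.false_of_starts_mem hC hA hB nA nB hAC.symm hBC.symm hAB hzA hzB (.inr rfl)
          (.inl hvC)
      · exact h.false_of_three_closedIn hA hB hC nA nB nC hAB hAC hBC hzA
          (fun hvA => out hA hxz.ne' hzA (lA hv hw hvA)) hzB
          (fun hvB => out hB hyz.ne' hzB (lB hv hw hvB)) hzC hvC
  refine ⟨?_, fun hu _ hw => key h hu hw, fun hv _ hw => key h.symm hv hw⟩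
  rintro - - ⟨hu, hv⟩
  by_cases huA : u ∈ A
  · exact h.false_of_starts_mem hA hB hC nB nC hAB hAC hBC hxB hxC (.inl huA)
      (.inl (lA hu hv huA))
  by_cases huB : u ∈ B
  · exact h.false_of_starts_mem hB hA hC nA nC hAB.symm hBC hAC hyA hyC (.inl huB)
      (.inl (lB hu hv huB))
  by_cases huC : u ∈ C
  · exact h.false_of_starts_mem hC hA hB nA nB hAC.symm hBC.symm hAB hzA hzB (.inl huC)
      (.inl (lC hu hv huC))
  exact h.false_of_three_closedIn hA hB hC nA nB nC hAB hAC hBC huA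
    (fun h => huA (lA hv hu h)) huB (fun h => huB (lB hv hu h)) huC (fun h => huC (lC hv hu h))

end Necessity

/-! ### Maximal pairs of disjoint paths -/

theorem KOneFree.false_of_compl_adj (hG : KOneFree G 4) {a b c d : V} (hab : Gᶜ.Adj a b)
    (hac : Gᶜ.Adj a c) (had : Gᶜ.Adj a d) (hbc : Gᶜ.Adj b c) (hbd : Gᶜ.Adj b d)
    (hcd : Gᶜ.Adj c d) : False := by
  simp only [compl_adj] at *
  have hf : ∀ i j, ¬ G.Adj (![a, b, c, d] i) (![a, b, c, d] j) := by
    intro i j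
    fin_cases i <;> fin_cases j <;> simp_all [G.adj_comm]
  refine hG ⟨⟨⟨![a, b, c, d], ?_⟩, ?_⟩⟩
  · intro i j hij
    fin_cases i <;> fin_cases j <;> simp_all
  · exact fun {i j} => iff_of_false (hf i j) (by simp)

theorem KOneFree.adj_of_compl_adj (hG : KOneFree G 4) {a b c d : V} (hab : a ≠ b)
    (hac : Gᶜ.Adj a c) (had : Gᶜ.Adj a d) (hbc : Gᶜ.Adj b c) (hbd : Gᶜ.Adj b d)
    (hcd : Gᶜ.Adj c d) : G.Adj a b := by
  by_contra h
  exact hG.false_of_compl_adj (by simp [hab, h]) hac had hbc hbd hcd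

/-- Disjoint paths with vertex lists `P` from `u` to `a` and `Q` from `v` to `b`, such that no pair
of disjoint paths starting in `u` and `v` covers all their vertices and at least one more. -/
structure MaxPair (G : SimpleGraph V) (u v : V) (P Q : List V) (a b : V) : Prop where
  left : Seg G P u a
  right : Seg G Q v b
  nodup : (P ++ Q).Nodup
  max : ∀ {l P' Q' a' b'}, l ≠ [] → l.Nodup → (∀ x ∈ l, x ∉ P ∧ x ∉ Q) → Seg G P' u a' →
    Seg G Q' v b' → (P' ++ Q').Perm (l ++ (P ++ Q)) → False

theorem exists_maxPair [Finite V] (G : SimpleGraph V) {u v : V} (huv : u ≠ v) :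
    ∃ P Q a b, MaxPair G u v P Q a b := by
  have := Fintype.ofFinite V
  let p : ℕ → Prop := fun n => ∃ P Q a b, Seg G P u a ∧ Seg G Q v b ∧ (P ++ Q).Nodup ∧
    (P ++ Q).length = n
  have hb : ∀ n, p n → n ≤ Fintype.card V := by
    rintro _ ⟨P, Q, a, b, _, _, hn, rfl⟩
    exact hn.length_le_card
  have h0 : p 2 := ⟨[u], [v], u, v, .single u, .single v, by simpa using huv, rfl⟩
  classical
  obtain ⟨P, Q, a, b, hP, hQ, hn, hl⟩ := Nat.findGreatest_spec (P := p) (hb 2 h0) h0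
  refine ⟨P, Q, a, b, hP, hQ, hn, fun {l P' Q' a' b'} hne hnl hd hP' hQ' hp => ?_⟩
  have hnd : (P' ++ Q').Nodup := by
    rw [hp.nodup_iff, List.nodup_append']
    refine ⟨hnl, hn, fun x hx hx' => ?_⟩
    rcases List.mem_append.1 hx' with h | h
    exacts [(hd x hx).1 h, (hd x hx).2 h]
  have h1 : p (P' ++ Q').length := ⟨P', Q', a', b', hP', hQ', hnd, rfl⟩
  have h2 := Nat.le_findGreatest (hb _ h1) h1
  have h3 := List.length_pos_iff.2 hne
  rw [hp.length_eq, List.length_append, hl] at h2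
  omega

namespace MaxPair

variable {u v a b h h' w w₁ w₂ : V} {P Q A T B : List V}

theorem symm (M : MaxPair G u v P Q a b) : MaxPair G v u Q P b a :=
  ⟨M.right, M.left, (List.perm_append_comm.nodup_iff).1 M.nodup,
    fun hne hn hd hP hQ hp => M.max hne hn (fun x hx => (hd x hx).symm) hQ hP
      (List.perm_append_comm.trans (hp.trans (List.perm_append_comm.append_left _)))⟩

theorem ne (M : MaxPair G u v P Q a b) {x y : V} (hx : x ∈ P) (hy : y ∈ Q) : x ≠ y := by
  rintro rfl
  exact List.disjoint_of_nodup_append M.nodup hx hy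

theorem false_of_perm (M : MaxPair G u v P Q a b) (hP : h ∉ P) (hQ : h ∉ Q) {P' Q' : List V}
    {a' b' : V} (hP' : Seg G P' u a') (hQ' : Seg G Q' v b')
    (hp : (P' ++ Q').Perm (h :: (P ++ Q))) : False :=
  M.max (l := [h]) (by simp) (by simp) (by simpa using ⟨hP, hQ⟩) hP' hQ' hp

theorem compl_adj_end (M : MaxPair G u v P Q a b) (hP : h ∉ P) (hQ : h ∉ Q) : Gᶜ.Adj a h := by
  rw [compl_adj]
  refine ⟨fun e => hP (e ▸ M.left.last_mem), fun hadj => ?_⟩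
  refine M.false_of_perm hP hQ (M.left.concat hadj) M.right ?_
  classical
  refine List.perm_iff_count.2 fun x => ?_
  simp only [List.count_append, List.count_cons, List.count_nil]
  omega

theorem false_of_adj_ends (M : MaxPair G u v P Q a b) (hP : h ∉ P) (hQ : h ∉ Q) (hw : w ∈ P)
    (hadj : G.Adj w h) (hab : G.Adj a b) : False := by
  obtain ⟨A, B, rfl⟩ := List.append_of_mem hw
  obtain ⟨e, he⟩ := M.right.append_reverse_tail M.left hab.symm
  refine M.false_of_perm hP hQ (M.left.left_of_append.concat hadj) he ?_
  classical
  refine List.perm_iff_count.2 fun x => ?_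
  simp only [List.count_append, List.count_cons, List.count_nil, List.count_reverse]
  omega

theorem exists_adj_uncovered (M : MaxPair G u v P Q a b) (hG : G.Preconnected) (hP : h ∉ P)
    (hQ : h ∉ Q) : ∃ w h, (w ∈ P ∨ w ∈ Q) ∧ h ∉ P ∧ h ∉ Q ∧ G.Adj w h := by
  by_contra! hc
  obtain ⟨p⟩ := hG u h
  have : ∀ {c d} (_ : G.Walk c d), (c ∈ P ∨ c ∈ Q) → (d ∈ P ∨ d ∈ Q) := by
    intro c d p
    induction p with
    | nil => exact id
    | cons hcd _ ih =>
      refine fun h => ih ?_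
      by_contra hn
      rw [not_or] at hn
      exact hc _ _ h hn.1 hn.2 hcd
  rcases this p (.inl M.left.head_mem) with h | h
  exacts [hP h, hQ h]

theorem compl_adj_ends (M : MaxPair G u v P Q a b) (hG : G.Preconnected) (hP : h ∉ P)
    (hQ : h ∉ Q) : Gᶜ.Adj a b := by
  rw [compl_adj]
  refine ⟨M.ne M.left.last_mem M.right.last_mem, fun hab => ?_⟩
  obtain ⟨w, k, hw | hw, hkP, hkQ, hwk⟩ := M.exists_adj_uncovered hG hP hQ
  · exact M.false_of_adj_ends hkP hkQ hw hwk hab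
  · exact M.symm.false_of_adj_ends hkQ hkP hw hwk hab.symm

theorem adj_uncovered (M : MaxPair G u v P Q a b) (hG : G.Preconnected) (h4 : KOneFree G 4)
    (hP : h ∉ P) (hQ : h ∉ Q) (hP' : h' ∉ P) (hQ' : h' ∉ Q) (hne : h ≠ h') : G.Adj h h' :=
  h4.adj_of_compl_adj hne (M.compl_adj_end hP hQ).symm (M.symm.compl_adj_end hQ hP).symm
    (M.compl_adj_end hP' hQ').symm (M.symm.compl_adj_end hQ' hP').symm
    (M.compl_adj_ends hG hP hQ)

/-- Any two uncovered vertices are joined by a path of uncovered vertices. -/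
theorem exists_seg_uncovered (M : MaxPair G u v P Q a b) (hG : G.Preconnected)
    (h4 : KOneFree G 4) (hP : h ∉ P) (hQ : h ∉ Q) (hP' : h' ∉ P) (hQ' : h' ∉ Q) :
    ∃ l, Seg G l h h' ∧ l.Nodup ∧ ∀ x ∈ l, x ∉ P ∧ x ∉ Q := by
  rcases eq_or_ne h h' with rfl | hne
  · exact ⟨[h], .single h, by simp, by simpa using ⟨hP, hQ⟩⟩
  · refine ⟨[h, h'], (Seg.single h').cons (M.adj_uncovered hG h4 hP hQ hP' hQ' hne),
      by simpa using hne, ?_⟩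
    simp only [List.mem_cons, List.not_mem_nil, or_false]
    rintro x (rfl | rfl)
    exacts [⟨hP, hQ⟩, ⟨hP', hQ'⟩]

theorem right_ne_nil (M : MaxPair G u v (A ++ w :: T) Q a b) (hP : h ∉ A ++ w :: T) (hQ : h ∉ Q)
    (hwh : G.Adj w h) : T ≠ [] := by
  rintro rfl
  have := M.compl_adj_end hP hQ
  rw [← M.left.eq_of_append_nil] at this
  exact this.2 hwh

/-- The successor on `P` of a neighbour of an uncovered vertex is not adjacent to an uncovered
vertex. -/
theorem compl_adj_next {t : V} (M : MaxPair G u v (A ++ w :: T) Q a b) (hG : G.Preconnected)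
    (h4 : KOneFree G 4) (hP : h ∉ A ++ w :: T) (hQ : h ∉ Q) (hwh : G.Adj w h)
    (hT : Seg G T t a) (hP' : h' ∉ A ++ w :: T) (hQ' : h' ∉ Q) : Gᶜ.Adj t h' := by
  rw [compl_adj]
  refine ⟨?_, fun hth => ?_⟩
  · rintro rfl
    exact hP' (by simp [hT.head_mem])
  obtain ⟨l, hl, hn, hd⟩ := M.exists_seg_uncovered hG h4 hP hQ hP' hQ'
  refine M.max hl.ne_nil hn hd ((M.left.left_of_append.append hl hwh).append hT hth.symm)
    M.right ?_
  classical
  refine List.perm_iff_count.2 fun x => ?_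
  simp only [List.count_append, List.count_cons, List.count_nil]
  omega

/-- The successor on `P` of a neighbour of an uncovered vertex is not adjacent to the end of
`Q`. -/
theorem compl_adj_next_end {t : V} (M : MaxPair G u v (A ++ w :: T) Q a b)
    (hP : h ∉ A ++ w :: T) (hQ : h ∉ Q) (hwh : G.Adj w h) (hT : Seg G T t a) : Gᶜ.Adj t b := by
  rw [compl_adj]
  refine ⟨M.ne (by simp [hT.head_mem]) M.right.last_mem, fun htb => ?_⟩
  refine M.false_of_perm hP hQ (M.left.left_of_append.concat hwh) (M.right.append hT htb.symm) ?_
  classical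
  refine List.perm_iff_count.2 fun x => ?_
  simp only [List.count_append, List.count_cons, List.count_nil]
  omega

/-- Two neighbours of the uncovered set on `P` would have successors which are independent together
with the end of `Q` and an uncovered vertex. -/
theorem false_of_two_adj (M : MaxPair G u v (A ++ w₁ :: (B ++ w₂ :: T)) Q a b)
    (hG : G.Preconnected) (h4 : KOneFree G 4)
    (hP : h ∉ A ++ w₁ :: (B ++ w₂ :: T)) (hQ : h ∉ Q) (h₁ : G.Adj w₁ h)
    (hP' : h' ∉ A ++ w₁ :: (B ++ w₂ :: T)) (hQ' : h' ∉ Q) (h₂ : G.Adj w₂ h') : False := by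
  obtain ⟨t₁, ht₁, hwt₁⟩ := M.left.right_of_append (l₁ := A) (by simp)
  have M' : MaxPair G u v ((A ++ w₁ :: B) ++ w₂ :: T) Q a b := by simpa using M
  have hP'' : h' ∉ (A ++ w₁ :: B) ++ w₂ :: T := by simpa using hP'
  have hP3 : h ∉ (A ++ w₁ :: B) ++ w₂ :: T := by simpa using hP
  obtain ⟨t₂, ht₂, hwt₂⟩ := M'.left.right_of_append (M'.right_ne_nil hP'' hQ' h₂)
  have c₁ := M.compl_adj_next hG h4 hP hQ h₁ ht₁ hP' hQ'
  have c₂ := M'.compl_adj_next hG h4 hP'' hQ' h₂ ht₂ hP'' hQ'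
  have d₁ := M.compl_adj_next_end hP hQ h₁ ht₁
  have d₂ := M'.compl_adj_next_end hP'' hQ' h₂ ht₂
  have hb := M.symm.compl_adj_end hQ' hP'
  have hB : B ≠ [] := by
    rintro rfl
    have : w₂ = t₁ := Seg.eq_of_nil_append ht₁
    exact c₁.2 (this ▸ h₂)
  obtain ⟨m, hm, hmw⟩ := ht₁.init_of_append hB
  have hne : t₁ ≠ t₂ := by
    have hn := List.Nodup.of_append_left M.nodup
    have h1 := List.Nodup.of_append_right hn
    have h2 := List.disjoint_of_nodup_append (List.nodup_cons.1 h1).2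
    rintro rfl
    exact h2 hm.head_mem (by simp [ht₂.head_mem])
  have hadj : G.Adj t₁ t₂ := h4.adj_of_compl_adj hne d₁ c₁ d₂ c₂ hb
  obtain ⟨l, hl, hn, hd⟩ := M.exists_seg_uncovered hG h4 hP hQ hP' hQ'
  refine M.max hl.ne_nil hn hd
    ((((M.left.left_of_append.append hl h₁).concat h₂.symm).append hm.reverse hmw.symm).append ht₂
      hadj) M.right ?_
  classical
  refine List.perm_iff_count.2 fun x => ?_
  simp only [List.count_append, List.count_cons, List.count_nil, List.count_reverse]
  omega

end MaxPair

/-! ### The part of a path behind a neighbour of an uncovered vertex -/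

/-- A maximal pair of paths whose first path is split as `A, w, T`, where `w` is adjacent to the
uncovered vertex `h` and the nonempty rest `T` goes from `t` to the end `a`. -/
structure Attached (G : SimpleGraph V) (u v : V) (A : List V) (w : V) (T Q : List V)
    (t a b h : V) : Prop where
  pair : MaxPair G u v (A ++ w :: T) Q a b
  not_mem_left : h ∉ A ++ w :: T
  not_mem_right : h ∉ Q
  adj : G.Adj w h
  seg : Seg G T t a
  next : G.Adj w t

theorem MaxPair.exists_attached {u v a b h w : V} {P Q : List V} (M : MaxPair G u v P Q a b)
    (hP : h ∉ P) (hQ : h ∉ Q) (hw : w ∈ P) (hwh : G.Adj w h) :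
    ∃ A T t, P = A ++ w :: T ∧ Attached G u v A w T Q t a b h := by
  obtain ⟨A, T, rfl⟩ := List.append_of_mem hw
  obtain ⟨t, ht, hwt⟩ := M.left.right_of_append (M.right_ne_nil hP hQ hwh)
  exact ⟨A, T, t, rfl, M, hP, hQ, hwh, ht, hwt⟩

namespace Attached

variable {u v a b h h' w t m x y : V} {Q A T : List V}

theorem compl_adj_of_ne (D : Attached G u v A w T Q t a b h) (hG : G.Preconnected)
    (h4 : KOneFree G 4) (hx : x ∈ A ++ w :: T) (hxw : x ≠ w) (hP' : h' ∉ A ++ w :: T)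
    (hQ' : h' ∉ Q) : Gᶜ.Adj x h' := by
  rw [compl_adj]
  refine ⟨fun e => hP' (e ▸ hx), fun hadj => ?_⟩
  have M := D.pair
  have hP := D.not_mem_left
  rcases List.mem_append.1 hx with hxA | hxT
  · obtain ⟨A₁, A₂, rfl⟩ := List.append_of_mem hxA
    simp only [List.append_assoc, List.cons_append] at M hP hP'
    exact M.false_of_two_adj hG h4 hP' hQ' hadj hP D.not_mem_right D.adj
  · rcases List.mem_cons.1 hxT with rfl | hxT
    · exact hxw rfl
    · obtain ⟨T₁, T₂, rfl⟩ := List.append_of_mem hxT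
      exact M.false_of_two_adj hG h4 hP D.not_mem_right D.adj hP' hQ' hadj

theorem nodup_left (D : Attached G u v A w T Q t a b h) : (A ++ w :: T).Nodup :=
  List.Nodup.of_append_left D.pair.nodup

theorem nodup_tail (D : Attached G u v A w T Q t a b h) : T.Nodup :=
  (List.nodup_cons.1 (List.Nodup.of_append_right D.nodup_left)).2

theorem ne_of_mem_tail (D : Attached G u v A w T Q t a b h) (hx : x ∈ T) : x ≠ w := by
  rintro rfl
  exact (List.nodup_cons.1 (List.Nodup.of_append_right D.nodup_left)).1 hx

theorem ne_of_mem_init (D : Attached G u v A w T Q t a b h) (hx : x ∈ A) : x ≠ w := by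
  rintro rfl
  exact List.disjoint_of_nodup_append D.nodup_left hx (by simp)

theorem ne_of_mem_init_of_mem_tail (D : Attached G u v A w T Q t a b h) (hx : x ∈ A)
    (hy : y ∈ T) : x ≠ y := by
  rintro rfl
  exact List.disjoint_of_nodup_append D.nodup_left hx (by simp [hy])

theorem compl_adj_tail (D : Attached G u v A w T Q t a b h) (hG : G.Preconnected)
    (h4 : KOneFree G 4) (hx : x ∈ T) (hP' : h' ∉ A ++ w :: T) (hQ' : h' ∉ Q) : Gᶜ.Adj x h' :=
  D.compl_adj_of_ne hG h4 (by simp [hx]) (D.ne_of_mem_tail hx) hP' hQ'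

theorem compl_adj_init (D : Attached G u v A w T Q t a b h) (hG : G.Preconnected)
    (h4 : KOneFree G 4) (hx : x ∈ A) (hP' : h' ∉ A ++ w :: T) (hQ' : h' ∉ Q) : Gᶜ.Adj x h' :=
  D.compl_adj_of_ne hG h4 (by simp [hx]) (D.ne_of_mem_init hx) hP' hQ'

theorem compl_adj_end (D : Attached G u v A w T Q t a b h) : Gᶜ.Adj b h :=
  D.pair.symm.compl_adj_end D.not_mem_right D.not_mem_left

theorem compl_adj_ends (D : Attached G u v A w T Q t a b h) (hG : G.Preconnected) : Gᶜ.Adj a b :=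
  D.pair.compl_adj_ends hG D.not_mem_left D.not_mem_right

/-- The tail closes up to a cycle, so an edge from `b` to any of its vertices would allow `Q` to be
extended by the whole tail, while the first path turns from `w` to `h`. -/
theorem compl_adj_tail_end (D : Attached G u v A w T Q t a b h) (hG : G.Preconnected)
    (h4 : KOneFree G 4) (hx : x ∈ T) : Gᶜ.Adj x b := by
  have M := D.pair
  have htb := M.compl_adj_next_end D.not_mem_left D.not_mem_right D.adj D.seg
  have hth := M.compl_adj_next hG h4 D.not_mem_left D.not_mem_right D.adj D.seg D.not_mem_left
    D.not_mem_right
  rw [compl_adj]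
  refine ⟨M.ne (by simp [hx]) M.right.last_mem, fun hxb => ?_⟩
  obtain ⟨T₁, T₂, rfl⟩ := List.append_of_mem hx
  rcases eq_or_ne T₁ [] with rfl | hne
  · exact htb.2 (D.seg.eq_of_nil_append ▸ hxb)
  obtain ⟨e, he, -⟩ := D.seg.init_of_append hne
  have hT₂ : ∃ l, l.Perm (x :: T₂) ∧ Seg G l x a := by
    refine ⟨x :: T₂, .refl _, ?_⟩
    rcases eq_or_ne T₂ [] with rfl | hne₂
    · have := D.seg.eq_of_append_nil
      exact this ▸ .single x
    · obtain ⟨s, hs, hxs⟩ := D.seg.right_of_append hne₂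
      exact hs.cons hxs
  obtain ⟨l, hlp, hl⟩ := hT₂
  have hat : a ≠ t := by
    rintro rfl
    exact List.disjoint_of_nodup_append D.nodup_tail he.head_mem (hlp.mem_iff.1 hl.last_mem)
  have hadj : G.Adj a t := h4.adj_of_compl_adj hat (D.compl_adj_ends hG)
    (M.compl_adj_end D.not_mem_left D.not_mem_right) htb hth D.compl_adj_end
  refine M.false_of_perm D.not_mem_left D.not_mem_right (M.left.left_of_append.concat D.adj)
    ((M.right.append hl hxb.symm).append he hadj) ?_
  classical
  refine List.perm_iff_count.2 fun z => ?_
  have := hlp.count_eq z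
  simp only [List.count_append, List.count_cons, List.count_nil] at this ⊢
  omega

theorem tail_clique (D : Attached G u v A w T Q t a b h) (hG : G.Preconnected)
    (h4 : KOneFree G 4) : ∀ x ∈ T, ∀ y ∈ T, x ≠ y → G.Adj x y := fun _ hx _ hy hxy =>
  h4.adj_of_compl_adj hxy (D.compl_adj_tail_end hG h4 hx)
    (D.compl_adj_tail hG h4 hx D.not_mem_left D.not_mem_right) (D.compl_adj_tail_end hG h4 hy)
    (D.compl_adj_tail hG h4 hy D.not_mem_left D.not_mem_right) D.compl_adj_end

/-- The tail can be traversed between any two vertices, which differ unless it is a single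
vertex. -/
theorem exists_seg_tail (D : Attached G u v A w T Q t a b h) (hG : G.Preconnected)
    (h4 : KOneFree G 4) (hx : x ∈ T) (hy : y ∈ T) (hxy : x = y → t = a) :
    ∃ l, l.Perm T ∧ Seg G l x y := by
  by_cases h : x = y
  · obtain rfl := hxy h
    have hT := D.seg.eq_singleton D.nodup_tail
    subst h hT
    obtain rfl := List.mem_singleton.1 hx
    exact ⟨[x], .refl _, .single x⟩
  · exact exists_seg_perm_of_clique D.nodup_tail (D.tail_clique hG h4) hx hy h

/-- The predecessor of `w` is adjacent to the end of `Q`. It is not adjacent to `a`, as the tail could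
then be inserted, reversed, before `w`. -/
theorem adj_pred (D : Attached G u v A w T Q t a b h) (hG : G.Preconnected) (h4 : KOneFree G 4)
    (hA : Seg G A u m) : G.Adj m b := by
  have M := D.pair
  have hma : Gᶜ.Adj m a := by
    rw [compl_adj]
    refine ⟨D.ne_of_mem_init_of_mem_tail hA.last_mem D.seg.last_mem, fun hma => ?_⟩
    refine M.false_of_perm D.not_mem_left D.not_mem_right
      (((hA.append D.seg.reverse hma).concat D.next.symm).concat D.adj) M.right ?_
    classical
    refine List.perm_iff_count.2 fun z => ?_
    simp only [List.count_append, List.count_cons, List.count_nil, List.count_reverse]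
    omega
  exact h4.adj_of_compl_adj (M.ne (by simp [hA.last_mem]) M.right.last_mem) hma
    (D.compl_adj_init hG h4 hA.last_mem D.not_mem_left D.not_mem_right) (D.compl_adj_ends hG).symm
    D.compl_adj_end (M.compl_adj_end D.not_mem_left D.not_mem_right)

end Attached

/-! ### Symmetry of the conditions in `u` and `v` -/

section Sufficiency

variable {S Q₁ : Set V} {u v a b c h h' w t s m x y z : V} {P Q A B T : List V}

theorem CondA.symm (h : CondA G u v) : CondA G v u := fun x hx h3 =>
  ⟨(h x hx h3).2.1, (h x hx h3).1, fun Q hQ hm => (h x hx h3).2.2 Q hQ hm.symm⟩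

theorem CondB.symm (h : CondB G u v) : CondB G v u := fun x y z hx hy hz hxy hyz hxz Q hQ =>
  ⟨fun hv hu hm => (h x y z hx hy hz hxy hyz hxz Q hQ).1 hu hv hm.symm,
    (h x y z hx hy hz hxy hyz hxz Q hQ).2.2, (h x y z hx hy hz hxy hyz hxz Q hQ).2.1⟩

theorem CondC.symm (h : CondC G u v) : CondC G v u := by
  rw [CondC, Set.pair_comm]
  exact h

theorem CondD.symm (h : CondD G u v) : CondD G v u := by
  intro x _ hx hc Q₁ hQ₁ _ y _ hy J₁ hJ₁ hv hu hcard hnb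
  have huJ := hJ₁.closedIn.1 hu
  have hux : x ≠ u := fun e => hQ₁.closedIn.1 huJ.1 e.symm
  obtain ⟨x', h1, h2, h3, h4⟩ := h x hux hx hc Q₁ hQ₁ huJ.1 y (fun e => huJ.2 e.symm) hy J₁ hJ₁
    hu hv hcard hnb
  exact ⟨x', h1, h3, h2, h4⟩

theorem CondA.numComponents_le (hA : CondA G u v) (hx : IsArticulationPoint G x)
    (hQ : IsComponent G {x}ᶜ Q₁) (hu : u ∈ Q₁) (hv : v ∈ Q₁) : numComponents G {x}ᶜ ≤ 2 := by
  by_contra hc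
  exact (hA x hx (by omega)).2.2 Q₁ hQ ⟨hu, hv⟩

theorem two_lt_ncard_of_mem [Finite V] (hu : u ∈ S) (hv : v ∈ S) (hc : c ∈ S) (huv : u ≠ v)
    (huc : u ≠ c) (hvc : v ≠ c) : 2 < S.ncard :=
  (Set.two_lt_ncard_iff (Set.toFinite S)).2 ⟨u, v, c, hu, hv, hc, huv, huc, hvc⟩

/-! ### Both paths meet the neighbourhood of the uncovered set -/

namespace Attached

/-- If the uncovered set has neighbours on both paths, then the first of them is the start. -/
theorem init_eq_nil {S : List V} (D : Attached G u v A w T (B ++ z :: S) t a b h)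
    (D' : Attached G v u B z S (A ++ w :: T) s b a h') (hG : G.Preconnected)
    (h4 : KOneFree G 4) : A = [] := by
  by_contra hA
  have M := D.pair
  obtain ⟨m, hm, -⟩ := M.left.init_of_append hA
  have hmb := D.adj_pred hG h4 hm
  obtain ⟨l, hl, hn, hd⟩ := M.exists_seg_uncovered hG h4 D'.not_mem_right D'.not_mem_left
    D.not_mem_left D.not_mem_right
  refine M.max hl.ne_nil hn hd (hm.append D'.seg.reverse hmb)
    (((M.right.left_of_append.append hl D'.adj).concat D.adj.symm).append D.seg D.next) ?_
  classical
  refine List.perm_iff_count.2 fun z => ?_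
  simp only [List.count_append, List.count_cons, List.count_nil, List.count_reverse]
  omega

/-- An edge between the two tails can only leave the first tail at its initial vertex. -/
theorem eq_of_adj_tails {S : List V} (D : Attached G u v [] u T ([] ++ v :: S) t a b h)
    (D' : Attached G v u [] v S ([] ++ u :: T) s b a h') (hG : G.Preconnected)
    (h4 : KOneFree G 4) (hx : x ∈ T) (hy : y ∈ S) (hxy : G.Adj x y) : x = t ∧ t ≠ a := by
  by_contra hc
  have M := D.pair
  obtain ⟨l, hlp, hl⟩ := D.exists_seg_tail hG h4 D.seg.head_mem hx
    (fun e => by_contra fun h => hc ⟨e.symm, h⟩)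
  obtain ⟨l', e, hlp', hl'⟩ : ∃ l e, l.Perm S ∧ Seg G l y e := by
    by_cases hys : y = s
    · exact ⟨S, b, .refl _, hys ▸ D'.seg⟩
    · obtain ⟨l, h1, h2⟩ := D'.exists_seg_tail hG h4 hy D'.seg.head_mem (fun h => absurd h hys)
      exact ⟨l, s, h1, h2⟩
  refine M.false_of_perm D'.not_mem_right D'.not_mem_left ((hl.append hl' hxy).cons D.next)
    ((Seg.single v).concat D'.adj) ?_
  classical
  refine List.perm_iff_count.2 fun z => ?_
  have := hlp.count_eq z
  have := hlp'.count_eq z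
  simp only [List.count_append, List.count_cons, List.count_nil] at this ⊢
  omega

/-- If the two tails are joined by an edge at `t`, then `t` is the only vertex of the first tail
adjacent to `u` or `v`. -/
theorem eq_of_adj_start {S : List V} (D : Attached G u v [] u T ([] ++ v :: S) t a b h)
    (D' : Attached G v u [] v S ([] ++ u :: T) s b a h') (hG : G.Preconnected)
    (h4 : KOneFree G 4) (hts : G.Adj t s) (hx : x ∈ T) (hux : G.Adj u x ∨ G.Adj v x) :
    x = t := by
  by_contra hxt
  have M := D.pair
  obtain ⟨l, hlp, hl⟩ := D.exists_seg_tail hG h4 hx D.seg.head_mem (fun e => absurd e hxt)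
  have hl' := hl.append D'.seg hts
  rcases hux with hux | hux
  · refine M.false_of_perm D'.not_mem_right D'.not_mem_left (hl'.cons hux)
      ((Seg.single v).concat D'.adj) ?_
    classical
    refine List.perm_iff_count.2 fun z => ?_
    have := hlp.count_eq z
    simp only [List.count_append, List.count_cons, List.count_nil] at this ⊢
    omega
  · refine M.false_of_perm D.not_mem_left D.not_mem_right ((Seg.single u).concat D.adj)
      (hl'.cons hux) ?_
    classical
    refine List.perm_iff_count.2 fun z => ?_
    have := hlp.count_eq z
    simp only [List.count_append, List.count_cons, List.count_nil] at this ⊢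
    omega

/-- If the uncovered set has neighbours on both paths, then `u` and `v` together with the tails
`T`, `S` and the uncovered set violate `CondC` or `CondD`. -/
theorem false_of_both [Finite V] {S : List V} (D : Attached G u v A w T (B ++ z :: S) t a b h)
    (D' : Attached G v u B z S (A ++ w :: T) s b a h') (hG : G.Preconnected)
    (h4 : KOneFree G 4) (hA : CondA G u v) (hC : CondC G u v) (hD : CondD G u v) : False := by
  obtain rfl := D.init_eq_nil D' hG h4
  obtain rfl := D'.init_eq_nil D hG h4
  obtain rfl : w = u := D.pair.left.eq_of_nil_append
  obtain rfl : z = v := D.pair.right.eq_of_nil_append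
  rename' w => u, z => v
  let H : Set V := {x | x ∉ [] ++ u :: T ∧ x ∉ [] ++ v :: S}
  have hcov : ∀ x, x = u ∨ x = v ∨ x ∈ T ∨ x ∈ S ∨ x ∈ H := by
    intro x
    simp only [H, List.nil_append, List.mem_cons, Set.mem_ofPred_eq]
    tauto
  have hTu : ∀ x ∈ T, x ≠ u := fun x hx => D.ne_of_mem_tail hx
  have hTv : ∀ x ∈ T, x ≠ v := fun x hx => D.pair.ne (by simp [hx]) (by simp)
  have hSu : ∀ x ∈ S, x ≠ u := fun x hx => D'.pair.ne (by simp [hx]) (by simp)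
  have hSv : ∀ x ∈ S, x ≠ v := fun x hx => D'.ne_of_mem_tail hx
  have huv : u ≠ v := D.pair.ne (by simp) (by simp)
  have hHu : ∀ x ∈ H, x ≠ u := by rintro x hx rfl; exact hx.1 (by simp)
  have hHv : ∀ x ∈ H, x ≠ v := by rintro x hx rfl; exact hx.2 (by simp)
  have hTS : ∀ x ∈ T, x ∉ S := fun x hx hx' => D.pair.ne (x := x) (by simp [hx])
    (by simp [hx']) rfl
  have hHT : ∀ x ∈ H, x ∉ T := fun x hx hx' => hx.1 (by simp [hx'])
  have hHS : ∀ x ∈ H, x ∉ S := fun x hx hx' => hx.2 (by simp [hx'])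
  have nTH : ∀ x ∈ T, ∀ y ∈ H, ¬ G.Adj x y := fun x hx y hy =>
    (D.compl_adj_tail hG h4 hx hy.1 hy.2).2
  have nSH : ∀ x ∈ S, ∀ y ∈ H, ¬ G.Adj x y := fun x hx y hy =>
    (D'.compl_adj_tail hG h4 hx hy.2 hy.1).2
  have hhH : h ∈ H := ⟨D.not_mem_left, D.not_mem_right⟩
  have hhH' : h' ∈ H := ⟨D'.not_mem_right, D'.not_mem_left⟩
  have aTS := fun {x y} (hx : x ∈ T) (hy : y ∈ S) (hxy : G.Adj x y) =>
    D.eq_of_adj_tails D' hG h4 hx hy hxy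
  have aST := fun {x y} (hx : x ∈ S) (hy : y ∈ T) (hxy : G.Adj x y) =>
    D'.eq_of_adj_tails D hG h4 hx hy hxy
  by_cases hts : ∃ x ∈ T, ∃ y ∈ S, G.Adj x y
  · obtain ⟨x, hx, y, hy, hxy⟩ := hts
    obtain ⟨rfl, hta⟩ := aTS hx hy hxy
    obtain ⟨rfl, hsb⟩ := aST hy hx hxy.symm
    rename' x => t, y => s
    have oT := fun {x} (hx : x ∈ T) h => D.eq_of_adj_start D' hG h4 hxy hx h
    have oS := fun {x} (hx : x ∈ S) h => D'.eq_of_adj_start D hG h4 hxy.symm hx h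
    have cT : ClosedIn G {t}ᶜ {x | x ∈ T ∧ x ≠ t} := by
      refine ⟨fun x hx => hx.2, fun x hx y hy hadj => ⟨?_, hy⟩⟩
      rcases hcov y with rfl | rfl | h1 | h1 | h1
      · exact absurd (oT hx.1 (.inl hadj.symm)) hx.2
      · exact absurd (oT hx.1 (.inr hadj.symm)) hx.2
      · exact h1
      · exact absurd (aTS hx.1 h1 hadj).1 hx.2
      · exact absurd hadj (nTH x hx.1 y h1)
    have hat : a ∈ {x | x ∈ T ∧ x ≠ t} := ⟨D.seg.last_mem, hta.symm⟩
    have artT : IsArticulationPoint G t := isArticulationPoint_iff.2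
      (not_preconnected_of_closedIn cT hat (b := u) (hTu t D.seg.head_mem).symm
        fun hu => hTu u hu.1 rfl)
    have cQ : ClosedIn G {t}ᶜ ({t}ᶜ \ {x | x ∈ T ∧ x ≠ t}) := cT.diff
    have mQ : ∀ x, x = u ∨ x = v ∨ x ∈ S ∨ x ∈ H → x ∈ ({t}ᶜ \ {x | x ∈ T ∧ x ≠ t} : Set V) := by
      intro x hx
      have : x ∉ T := by
        rcases hx with rfl | rfl | hx | hx
        exacts [fun h => hTu _ h rfl, fun h => hTv _ h rfl, fun h => hTS _ h hx, hHT x hx]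
      exact ⟨fun e => this (e ▸ D.seg.head_mem), fun h => this h.1⟩
    have mQ' : ∀ x ∈ ({t}ᶜ \ {x | x ∈ T ∧ x ≠ t} : Set V), x = u ∨ x = v ∨ x ∈ S ∨ x ∈ H := by
      rintro x ⟨hx1, hx2⟩
      rcases hcov x with h1 | h1 | h1 | h1 | h1
      · exact .inl h1
      · exact .inr (.inl h1)
      · exact absurd ⟨h1, hx1⟩ hx2
      · exact .inr (.inr (.inl h1))
      · exact .inr (.inr (.inr h1))
    generalize ({t}ᶜ \ {x | x ∈ T ∧ x ≠ t} : Set V) = Q₁ at cQ mQ mQ'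
    let J : Set V := {x | x = u ∨ x = v ∨ x ∈ H}
    have sJ : ∀ x ∈ J, x ∉ S := by
      rintro x (rfl | rfl | hx) hxS
      exacts [hSu _ hxS rfl, hSv _ hxS rfl, hHS x hx hxS]
    have cJ : ClosedIn G (Q₁ \ {s}) J := by
      refine ⟨fun x hx => ⟨mQ x ?_, ?_⟩, fun x hx y hy hadj => ?_⟩
      · rcases hx with h | h | h <;> simp [h]
      · exact fun e => sJ x hx (e ▸ D'.seg.head_mem)
      · rcases mQ' y hy.1 with h1 | h1 | h1 | h1
        · exact .inl h1
        · exact .inr (.inl h1)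
        · refine absurd ?_ hy.2
          rcases hx with rfl | rfl | h2
          · exact oS h1 (.inr hadj)
          · exact oS h1 (.inl hadj)
          · exact absurd hadj.symm (nSH y h1 x h2)
        · exact .inr (.inr h1)
    have lJ : ∀ x ∈ J, Linked G (Q₁ \ {s}) u x := by
      have lH : ∀ x ∈ H, Linked G (Q₁ \ {s}) u x := by
        intro x hx
        refine (Linked.of_adj D.adj (cJ.1 (.inr (.inr hhH)))).trans ?_
        rcases eq_or_ne h x with rfl | hne
        · exact .refl _
        · exact .of_adj (D.pair.adj_uncovered hG h4 hhH.1 hhH.2 hx.1 hx.2 hne)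
            (cJ.1 (.inr (.inr hx)))
      rintro x (rfl | rfl | hx)
      · exact .refl _
      · exact (lH h' hhH').trans (.of_adj D'.adj.symm (cJ.1 (.inr (.inl rfl))))
      · exact lH x hx
    have hJ := isComponent_of_linked cJ (.inl rfl) lJ
    have lQ : ∀ x ∈ Q₁, Linked G {t}ᶜ u x := by
      have lJ' : ∀ x ∈ J, Linked G {t}ᶜ u x := by
        intro x hx A hA hu
        have hA' : ClosedIn G (Q₁ \ {s}) (A ∩ (Q₁ \ {s})) :=
          ⟨Set.inter_subset_right, fun a ha b hb hab =>
            ⟨hA.2 a ha.1 b (cQ.1 hb.1) hab, hb⟩⟩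
        exact (lJ x hx _ hA' ⟨hu, cJ.1 (.inl rfl)⟩).1
      intro x hx
      rcases mQ' x hx with h1 | h1 | h1 | h1
      · exact lJ' x (.inl h1)
      · exact lJ' x (.inr (.inl h1))
      · refine (lJ' v (.inr (.inl rfl))).trans ?_
        have hs := D'.seg.head_mem
        refine (Linked.of_adj D'.next (cQ.1 (mQ s (.inr (.inr (.inl hs)))))).trans ?_
        rcases eq_or_ne s x with rfl | hne
        · exact .refl _
        · exact .of_adj (D'.tail_clique hG h4 s hs x h1 hne) (cQ.1 hx)
      · exact lJ' x (.inr (.inr h1))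
    have huQ := mQ u (.inl rfl)
    have hvQ := mQ v (.inr (.inl rfl))
    have hQ := isComponent_of_linked cQ huQ lQ
    have hs := D'.seg.head_mem
    have artS : IsArticulationPointOf G Q₁ s := ⟨mQ s (.inr (.inr (.inl hs))),
      not_preconnected_of_closedIn cJ (a := u) (b := b) (.inl rfl)
        ⟨mQ b (.inr (.inr (.inl D'.seg.last_mem))), hsb.symm⟩
        fun hb => sJ b hb D'.seg.last_mem⟩
    obtain ⟨x', h1, h2, h3, h4'⟩ := hD t (hTu t D.seg.head_mem) artT
      (hA.numComponents_le artT hQ huQ hvQ) Q₁ hQ huQ s (hSu s hs) artS J hJ (.inl rfl)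
      (.inr (.inl rfl))
      (two_lt_ncard_of_mem (u := u) (v := v) (c := h) (.inl rfl) (.inr (.inl rfl))
        (.inr (.inr hhH)) huv (hHu h hhH).symm (hHv h hhH).symm) (by
        intro x hx htx
        rcases mQ' x hx with h1 | h1 | h1 | h1
        · exact .inl (.inl h1)
        · exact .inl (.inr (.inl h1))
        · exact .inr (aST h1 D.seg.head_mem htx.symm).1
        · exact .inl (.inr (.inr h1)))
    have hxH : x' ∈ H := (h1.resolve_left h2).resolve_left h3
    rcases h4' with h | h
    exacts [nTH t D.seg.head_mem x' hxH h.symm, nSH s hs x' hxH h.symm]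
  · push Not at hts
    have key : ∀ {X : Set V}, (∀ x ∈ X, x ≠ u ∧ x ≠ v) →
        (∀ x ∈ X, ∀ y, y ≠ u → y ≠ v → G.Adj x y → y ∈ X) → ClosedIn G ({u, v} : Set V)ᶜ X := by
      intro X h1 h2
      refine ⟨fun x hx => by simpa using h1 x hx, fun x hx y hy => ?_⟩
      simp only [Set.mem_compl_iff, Set.mem_insert_iff, Set.mem_singleton_iff, not_or] at hy
      exact h2 x hx y hy.1 hy.2
    have cT : ClosedIn G ({u, v} : Set V)ᶜ {x | x ∈ T} := by
      refine key (fun x hx => ⟨hTu x hx, hTv x hx⟩) fun x hx y h1 h2 hxy => ?_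
      rcases hcov y with h | h | h | h | h
      exacts [absurd h h1, absurd h h2, h, absurd hxy (hts x hx y h), absurd hxy (nTH x hx y h)]
    have cS : ClosedIn G ({u, v} : Set V)ᶜ {x | x ∈ S} := by
      refine key (fun x hx => ⟨hSu x hx, hSv x hx⟩) fun x hx y h1 h2 hxy => ?_
      rcases hcov y with h | h | h | h | h
      exacts [absurd h h1, absurd h h2, absurd hxy.symm (hts y h x hx), h,
        absurd hxy (nSH x hx y h)]
    have cH : ClosedIn G ({u, v} : Set V)ᶜ H := by
      refine key (fun x hx => ⟨hHu x hx, hHv x hx⟩) fun x hx y h1 h2 hxy => ?_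
      rcases hcov y with h | h | h | h | h
      exacts [absurd h h1, absurd h h2, absurd hxy.symm (nTH y h x hx),
        absurd hxy.symm (nSH y h x hx), h]
    exact hC ⟨not_preconnected_of_closedIn cT D.seg.head_mem (cH.1 hhH) (hHT h hhH),
      three_le_numComponents cT cS cH ⟨t, D.seg.head_mem⟩ ⟨s, D'.seg.head_mem⟩ ⟨h, hhH⟩
        (Set.disjoint_left.2 hTS) (Set.disjoint_right.2 hHT) (Set.disjoint_right.2 hHS)⟩

end Attached

end Sufficiency

/-! ### Only the first path meets the neighbourhood of the uncovered set -/

section OneSided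

variable {u v a b c h h' w t m x y z e₁ e₂ : V} {P Q A B T K : List V}

/-- A clique is covered by disjoint paths from `u` to `e₁` and from `v` to `e₂`, apart from the
obvious exceptions. -/
theorem exists_two_seg_of_clique (hK : K.Nodup)
    (hadj : ∀ x ∈ K, ∀ y ∈ K, x ≠ y → G.Adj x y) (hu : u ∈ K) (hv : v ∈ K) (h₁ : e₁ ∈ K)
    (h₂ : e₂ ∈ K) (huv : u ≠ v) (h₁₂ : e₁ ≠ e₂) (h₁v : e₁ ≠ v) (h₂u : e₂ ≠ u)
    (hK₂ : e₁ = u → e₂ = v → ∀ x ∈ K, x = u ∨ x = v) :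
    ∃ C₁ C₂, (C₁ ++ C₂).Perm K ∧ Seg G C₁ u e₁ ∧ Seg G C₂ v e₂ := by
  classical
  have erase : ∀ {a b c : V}, a ∈ K → b ∈ K → b ≠ a → c ∈ K → c ≠ a → b ≠ c →
      ∃ l, (a :: l).Perm K ∧ Seg G l b c := by
    intro a b c ha hb hba hc hca hbc
    obtain ⟨l, hlp, hl⟩ := exists_seg_perm_of_clique (hK.erase a)
      (fun x hx y hy => hadj x (List.mem_of_mem_erase hx) y (List.mem_of_mem_erase hy))
      ((List.mem_erase_of_ne hba).2 hb) ((List.mem_erase_of_ne hca).2 hc) hbc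
    exact ⟨l, (hlp.cons a).trans (List.perm_cons_erase ha).symm, hl⟩
  by_cases h1 : e₁ = u
  · subst h1
    by_cases h2 : e₂ = v
    · subst h2
      refine ⟨[e₁], [e₂], ?_, .single _, .single _⟩
      refine (List.perm_ext_iff_of_nodup (by simpa using huv) hK).2 fun x => ?_
      constructor
      · intro hx
        rcases List.mem_cons.1 hx with rfl | hx
        · exact hu
        · exact List.mem_singleton.1 hx ▸ hv
      · intro hx
        simpa using hK₂ rfl rfl x hx
    · obtain ⟨l, hlp, hl⟩ := erase hu hv huv.symm h₂ h₂u (Ne.symm h2)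
      exact ⟨[e₁], l, hlp, .single _, hl⟩
  · by_cases h2 : e₂ = v
    · subst h2
      obtain ⟨l, hlp, hl⟩ := erase hv hu huv h₁ h₁v (Ne.symm h1)
      exact ⟨l, [e₂], (List.perm_append_singleton _ _).trans hlp, hl, .single _⟩
    · have hp := (List.perm_cons_erase hu).trans
        (((List.perm_cons_erase ((List.mem_erase_of_ne h1).2 h₁))).cons u)
      obtain ⟨l, hlp, hl⟩ := exists_seg_perm_of_clique ((hK.erase u).erase e₁)
        (fun x hx y hy => hadj x (List.mem_of_mem_erase (List.mem_of_mem_erase hx)) y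
          (List.mem_of_mem_erase (List.mem_of_mem_erase hy)))
        ((List.mem_erase_of_ne (Ne.symm h₁v)).2 ((List.mem_erase_of_ne huv.symm).2 hv))
        ((List.mem_erase_of_ne h₁₂.symm).2 ((List.mem_erase_of_ne h₂u).2 h₂)) (Ne.symm h2)
      exact ⟨[u, e₁], l, ((hlp.cons e₁).cons u).trans hp.symm,
        (Seg.single e₁).cons (hadj u hu e₁ h₁ (Ne.symm h1)), hl⟩

namespace Attached

/-- The vertices covered by neither path. -/
def uncovered (_ : Attached G u v A w T Q t a b h) : Set V := {x | x ∉ A ++ w :: T ∧ x ∉ Q}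

theorem mem_uncovered (D : Attached G u v A w T Q t a b h) : h ∈ D.uncovered :=
  ⟨D.not_mem_left, D.not_mem_right⟩

theorem mem_cases (D : Attached G u v A w T Q t a b h) (x : V) :
    x = w ∨ (x ∈ A ∨ x ∈ Q) ∨ x ∈ T ∨ x ∈ D.uncovered := by
  simp only [uncovered, Set.mem_ofPred_eq, List.mem_append, List.mem_cons]
  tauto

theorem ne_of_mem_right (D : Attached G u v A w T Q t a b h) (hx : x ∈ A ∨ x ∈ Q) : x ≠ w :=
  hx.elim D.ne_of_mem_init fun h => (D.pair.ne (by simp) h).symm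

theorem ne_of_mem_uncovered (D : Attached G u v A w T Q t a b h) (hx : x ∈ D.uncovered) :
    x ≠ w := by
  rintro rfl
  exact hx.1 (by simp)

theorem not_mem_tail (D : Attached G u v A w T Q t a b h) (hx : x ∈ A ∨ x ∈ Q) : x ∉ T :=
  fun hxT => hx.elim (fun h => D.ne_of_mem_init_of_mem_tail h hxT rfl)
    fun h => D.pair.ne (x := x) (by simp [hxT]) h rfl

theorem not_mem_uncovered (D : Attached G u v A w T Q t a b h) (hx : x ∈ A ∨ x ∈ Q) :
    x ∉ D.uncovered :=
  fun hxH => hx.elim (fun h => hxH.1 (by simp [h])) hxH.2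

theorem not_mem_uncovered_of_tail (D : Attached G u v A w T Q t a b h) (hx : x ∈ T) :
    x ∉ D.uncovered :=
  fun hxH => hxH.1 (by simp [hx])

/-- If no vertex of `Q` has an uncovered neighbour, then `w` separates the uncovered set from the
remaining vertices. -/
theorem closedIn_uncovered (D : Attached G u v A w T Q t a b h) (hG : G.Preconnected)
    (h4 : KOneFree G 4) (hQ : ∀ x ∈ Q, ∀ y ∈ D.uncovered, ¬ G.Adj x y) :
    ClosedIn G {w}ᶜ D.uncovered := by
  refine ⟨fun x hx => D.ne_of_mem_uncovered hx, fun x hx y hy hxy => ?_⟩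
  rcases D.mem_cases y with h1 | (h1 | h1) | h1 | h1
  · exact absurd h1 hy
  · exact absurd hxy.symm (D.compl_adj_init hG h4 h1 hx.1 hx.2).2
  · exact absurd hxy.symm (hQ y h1 x hx)
  · exact absurd hxy.symm (D.compl_adj_tail hG h4 h1 hx.1 hx.2).2
  · exact h1

/-- If there is no edge between the tail and the remaining covered vertices, then `G - w` has at
least three components, one of them met by `Q`. -/
theorem three_le_numComponents_of_forall_not_adj [Finite V] (D : Attached G u v A w T Q t a b h)
    (hG : G.Preconnected) (h4 : KOneFree G 4)
    (hQ : ∀ x ∈ Q, ∀ y ∈ D.uncovered, ¬ G.Adj x y)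
    (hn : ∀ x, x ∈ A ∨ x ∈ Q → ∀ y ∈ T, ¬ G.Adj x y) :
    IsArticulationPoint G w ∧ 3 ≤ numComponents G {w}ᶜ := by
  have cH := D.closedIn_uncovered hG h4 hQ
  have nH : ∀ x, x ∈ A ∨ x ∈ Q → ∀ y ∈ D.uncovered, ¬ G.Adj x y := fun x hx y hy hxy =>
    D.not_mem_uncovered hx (cH.2 y hy x (D.ne_of_mem_right hx) hxy.symm)
  have cT : ClosedIn G {w}ᶜ {x | x ∈ T} := by
    refine ⟨fun x hx => D.ne_of_mem_tail hx, fun x hx y hy hxy => ?_⟩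
    rcases D.mem_cases y with h1 | h1 | h1 | h1
    exacts [absurd h1 hy, absurd hxy.symm (hn y h1 x hx), h1,
      absurd hxy (D.compl_adj_tail hG h4 hx h1.1 h1.2).2]
  have cC : ClosedIn G {w}ᶜ {x | x ∈ A ∨ x ∈ Q} := by
    refine ⟨fun x hx => D.ne_of_mem_right hx, fun x hx y hy hxy => ?_⟩
    rcases D.mem_cases y with h1 | h1 | h1 | h1
    exacts [absurd h1 hy, h1, absurd hxy (hn x hx y h1), absurd hxy (nH x hx y h1)]
  have hv : v ∈ {x | x ∈ A ∨ x ∈ Q} := .inr D.pair.right.head_mem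
  refine ⟨isArticulationPoint_iff.2 (not_preconnected_of_closedIn cT D.seg.head_mem (cC.1 hv)
    (D.not_mem_tail hv)), three_le_numComponents cT cC cH ⟨t, D.seg.head_mem⟩ ⟨v, hv⟩
    ⟨h, D.mem_uncovered⟩ ?_ ?_ ?_⟩
  · exact Set.disjoint_right.2 fun x hx => D.not_mem_tail hx
  · exact Set.disjoint_left.2 fun x hx => D.not_mem_uncovered_of_tail hx
  · exact Set.disjoint_left.2 fun x hx => D.not_mem_uncovered hx

/-- If the uncovered set is attached to `u` only, then the rest of `G - u` is covered by a path
from `v`, unless `CondA` or `CondC` is violated. -/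
theorem false_of_init_nil [Finite V] (D : Attached G u v [] u T Q t a b h) (hG : G.Preconnected)
    (h4 : KOneFree G 4) (hQ : ∀ x ∈ Q, ∀ y ∈ D.uncovered, ¬ G.Adj x y) (hA : CondA G u v)
    (hC : CondC G u v) : False := by
  have M := D.pair
  have cH := D.closedIn_uncovered hG h4 hQ
  by_cases hn : ∀ x, x ∈ ([] : List V) ∨ x ∈ Q → ∀ y ∈ T, ¬ G.Adj x y
  · obtain ⟨h1, h2⟩ := D.three_le_numComponents_of_forall_not_adj hG h4 hQ hn
    exact (hA u h1 h2).1 rfl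
  push Not at hn
  obtain ⟨q₀, hq₀, y₀, hy₀, hqy₀⟩ := hn
  have hq₀ : q₀ ∈ Q := by simpa using hq₀
  by_cases hv : ∀ x ∈ Q, x ≠ v → ∀ y ∈ T, ¬ G.Adj x y
  · have hvb : b ≠ v := by
      rintro rfl
      have : q₀ = b := by
        by_contra hne
        exact hv q₀ hq₀ hne y₀ hy₀ hqy₀
      subst this
      exact (D.compl_adj_tail_end hG h4 hy₀).2 hqy₀.symm
    have huv : ∀ {y}, y ∈ ({u, v} : Set V)ᶜ → y ≠ u ∧ y ≠ v := by
      intro y hy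
      simpa using hy
    have hne : ∀ {y}, y ≠ u ∧ y ≠ v → y ∈ ({u, v} : Set V)ᶜ := by
      intro y hy
      simpa using hy
    have hTv : ∀ x ∈ T, x ≠ v := fun x hx => M.ne (by simp [hx]) M.right.head_mem
    have hHv : ∀ x ∈ D.uncovered, x ≠ v := by
      rintro x hx rfl
      exact hx.2 M.right.head_mem
    have cT : ClosedIn G ({u, v} : Set V)ᶜ {x | x ∈ T} := by
      refine ⟨fun x hx => hne ⟨D.ne_of_mem_tail hx, hTv x hx⟩, fun x hx y hy hxy => ?_⟩
      rcases D.mem_cases y with h1 | (h1 | h1) | h1 | h1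
      exacts [absurd h1 (huv hy).1, by simp at h1, absurd hxy.symm (hv y h1 (huv hy).2 x hx), h1,
        absurd hxy (D.compl_adj_tail hG h4 hx h1.1 h1.2).2]
    have cH' : ClosedIn G ({u, v} : Set V)ᶜ D.uncovered :=
      ⟨fun x hx => hne ⟨D.ne_of_mem_uncovered hx, hHv x hx⟩,
        fun x hx y hy => cH.2 x hx y (huv hy).1⟩
    have cQ : ClosedIn G ({u, v} : Set V)ᶜ {x | x ∈ Q ∧ x ≠ v} := by
      refine ⟨fun x hx => hne ⟨D.ne_of_mem_right (.inr hx.1), hx.2⟩, fun x hx y hy hxy => ?_⟩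
      rcases D.mem_cases y with h1 | (h1 | h1) | h1 | h1
      exacts [absurd h1 (huv hy).1, by simp at h1, ⟨h1, (huv hy).2⟩,
        absurd hxy (hv x hx.1 hx.2 y h1), absurd hxy (hQ x hx.1 y h1)]
    exact hC ⟨not_preconnected_of_closedIn cT D.seg.head_mem (cH'.1 D.mem_uncovered)
        (fun h => D.not_mem_uncovered_of_tail h D.mem_uncovered),
      three_le_numComponents cT cH' cQ ⟨t, D.seg.head_mem⟩ ⟨h, D.mem_uncovered⟩
        ⟨b, M.right.last_mem, hvb⟩
        (Set.disjoint_left.2 fun x hx => D.not_mem_uncovered_of_tail hx)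
        (Set.disjoint_right.2 fun x hx => D.not_mem_tail (.inr hx.1))
        (Set.disjoint_right.2 fun x hx => D.not_mem_uncovered (.inr hx.1))⟩
  -- an edge from the tail to `q ≠ v` lets the path from `v` absorb the tail
  push Not at hv
  obtain ⟨q, hq, hqv, x, hx, hqx⟩ := hv
  obtain ⟨Q₁, Q₂, rfl⟩ := List.append_of_mem hq
  have hQ₁ : Q₁ ≠ [] := by
    rintro rfl
    exact hqv M.right.eq_of_nil_append
  have hQ₂ : Q₂ ≠ [] := by
    rintro rfl
    have := D.compl_adj_tail_end hG h4 hx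
    rw [← M.right.eq_of_append_nil] at this
    exact this.2 hqx.symm
  obtain ⟨r, hr, hrq⟩ := M.right.init_of_append hQ₁
  obtain ⟨s, hs, hqs⟩ := M.right.right_of_append hQ₂
  have hrmem : r ∈ Q₁ ++ q :: Q₂ := by simp [hr.last_mem]
  have start : Seg G ([u] ++ [h]) u h := (Seg.single u).concat D.adj
  by_cases hrb : G.Adj r b
  · obtain ⟨l, e, hlp, hl⟩ : ∃ l e, l.Perm T ∧ Seg G l x e := by
      by_cases hxt : x = t
      · exact ⟨T, a, .refl _, hxt ▸ D.seg⟩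
      · obtain ⟨l, h1, h2⟩ := D.exists_seg_tail hG h4 hx D.seg.head_mem (fun h => absurd h hxt)
        exact ⟨l, t, h1, h2⟩
    refine M.false_of_perm D.not_mem_left D.not_mem_right start
      (((hr.append hs.reverse hrb).concat hqs.symm).append hl hqx) ?_
    classical
    refine List.perm_iff_count.2 fun z => ?_
    have := hlp.count_eq z
    simp only [List.count_append, List.count_cons, List.count_nil, List.count_reverse] at this ⊢
    omega
  · have hrT : ∀ y ∈ T, G.Adj r y := by
      intro y hy
      by_contra hry
      have hne : r ≠ b := by
        rintro rfl
        have := List.disjoint_of_nodup_append (List.Nodup.of_append_right M.nodup)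
        exact this hr.last_mem (by simp [hs.last_mem])
      refine hrb (h4.adj_of_compl_adj hne (c := y) (d := h) ?_ ?_
        (D.compl_adj_tail_end hG h4 hy).symm D.compl_adj_end
        (D.compl_adj_tail hG h4 hy D.not_mem_left D.not_mem_right))
      · exact (compl_adj G r y).2 ⟨(M.ne (by simp [hy]) hrmem).symm, hry⟩
      · exact (compl_adj G r h).2 ⟨fun e => D.not_mem_right (e ▸ hrmem),
          hQ r hrmem h D.mem_uncovered⟩
    -- enter the tail at an end vertex different from its exit `x`
    obtain ⟨y, hy, hyx⟩ : ∃ y ∈ T, y = x → t = a := by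
      by_cases hxt : x = t
      · exact ⟨a, D.seg.last_mem, fun h => hxt.symm.trans h.symm⟩
      · exact ⟨t, D.seg.head_mem, fun h => absurd h.symm hxt⟩
    obtain ⟨l, hlp, hl⟩ := D.exists_seg_tail hG h4 hy hx hyx
    refine M.false_of_perm D.not_mem_left D.not_mem_right start
      ((hr.append hl (hrT y hy)).append (hs.cons hqs) hqx.symm) ?_
    classical
    refine List.perm_iff_count.2 fun z => ?_
    have := hlp.count_eq z
    simp only [List.count_append, List.count_cons, List.count_nil] at this ⊢
    omega

/-- The tail cannot be passed on a way from the rest of the covered vertices to `w`. -/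
theorem false_of_seg_tail (D : Attached G u v A w T Q t a b h) (hA : Seg G A u m)
    (hmb : G.Adj m b) {l : List V} (hlp : l.Perm T) (hl : Seg G l x y) (hc : c ∈ A ∨ c ∈ Q)
    (hcx : G.Adj c x) (hyw : G.Adj y w) : False := by
  have M := D.pair
  rcases hc with hc | hc
  · obtain ⟨A₁, A₂, rfl⟩ := List.append_of_mem hc
    obtain ⟨e, he⟩ := M.right.append_reverse_tail hA hmb.symm
    refine M.false_of_perm D.not_mem_left D.not_mem_right
      (((hA.left_of_append.append hl hcx).concat hyw).concat D.adj) he ?_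
    classical
    refine List.perm_iff_count.2 fun z => ?_
    have := hlp.count_eq z
    simp only [List.count_append, List.count_cons, List.count_nil, List.count_reverse] at this ⊢
    omega
  · obtain ⟨Q₁, Q₂, rfl⟩ := List.append_of_mem hc
    obtain ⟨e, he⟩ := hA.append_reverse_tail M.right hmb
    refine M.false_of_perm D.not_mem_left D.not_mem_right he
      (((M.right.left_of_append.append hl hcx).concat hyw).concat D.adj) ?_
    classical
    refine List.perm_iff_count.2 fun z => ?_
    have := hlp.count_eq z
    simp only [List.count_append, List.count_cons, List.count_nil, List.count_reverse] at this ⊢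
    omega

/-- If the uncovered set is attached to a vertex `w ≠ u` of the first path only, then the vertices
before `w` and those of `Q` form a clique, attached to `w` and `t`, and one of `CondA`, `CondB`,
`CondD` is violated. -/
theorem false_of_init_ne_nil [Finite V] (D : Attached G u v A w T Q t a b h)
    (hG : G.Preconnected) (h4 : KOneFree G 4)
    (hQ : ∀ x ∈ Q, ∀ y ∈ D.uncovered, ¬ G.Adj x y) (hne : A ≠ []) (hcA : CondA G u v)
    (hcB : CondB G u v) (hcD : CondD G u v) : False := by
  have M := D.pair
  obtain ⟨m, hm, hmw⟩ := M.left.init_of_append hne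
  have hmb := D.adj_pred hG h4 hm
  have hC : Seg G (A ++ Q.reverse) u v := hm.append M.right.reverse hmb
  have cH := D.closedIn_uncovered hG h4 hQ
  have hC' : ∀ x ∈ A ++ Q.reverse, x ∈ A ∨ x ∈ Q := fun x hx => by simpa using hx
  have huC : u ∈ A ∨ u ∈ Q := .inl hm.head_mem
  have hvC : v ∈ A ∨ v ∈ Q := .inr M.right.head_mem
  have huv : u ≠ v := M.ne (by simp [hm.head_mem]) M.right.head_mem
  have htT := D.seg.head_mem
  have haT := D.seg.last_mem
  by_cases hn : ∀ x, x ∈ A ∨ x ∈ Q → ∀ y ∈ T, ¬ G.Adj x y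
  · obtain ⟨h1, h2⟩ := D.three_le_numComponents_of_forall_not_adj hG h4 hQ hn
    obtain ⟨K, hK, huK⟩ := exists_isComponent G (S := ({w} : Set V)ᶜ) (D.ne_of_mem_right huC)
    exact (hcA w h1 h2).2.2 K hK ⟨huK, Linked.of_seg hC
      (fun x hx => D.ne_of_mem_right (hC' x hx)) v hC.last_mem K hK.closedIn huK⟩
  push Not at hn
  obtain ⟨c, hc, y, hy, hcy⟩ := hn
  have key : ∀ c, c ∈ A ∨ c ∈ Q → ∀ y ∈ T, G.Adj c y → y = t ∧ t ≠ a := by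
    intro c hc y hy hcy
    by_contra hcon
    obtain ⟨l, hlp, hl⟩ := D.exists_seg_tail hG h4 hy htT (fun e => by_contra fun h => hcon ⟨e, h⟩)
    exact D.false_of_seg_tail hm hmb hlp hl hc hcy D.next.symm
  obtain ⟨rfl, hta⟩ := key c hc y hy hcy
  rename' y => t
  have hwT : ∀ x ∈ T, G.Adj w x → x = t := by
    intro x hx hwx
    by_contra hxt
    obtain ⟨l, hlp, hl⟩ := D.exists_seg_tail hG h4 htT hx (fun e => absurd e.symm hxt)
    exact D.false_of_seg_tail hm hmb hlp hl hc hcy hwx.symm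
  have nH : ∀ x, x ∈ A ∨ x ∈ Q → ∀ y ∈ D.uncovered, ¬ G.Adj x y := fun x hx y hy hxy =>
    D.not_mem_uncovered hx (cH.2 y hy x (D.ne_of_mem_right hx) hxy.symm)
  have clq : ∀ x, x ∈ A ∨ x ∈ Q → ∀ y, y ∈ A ∨ y ∈ Q → x ≠ y → G.Adj x y := by
    have h1 : ∀ x, x ∈ A ∨ x ∈ Q → Gᶜ.Adj x a ∧ Gᶜ.Adj x h := by
      intro x hx
      refine ⟨(compl_adj G x a).2 ⟨fun e => D.not_mem_tail hx (e ▸ haT), fun hxa => ?_⟩,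
        (compl_adj G x h).2 ⟨fun e => D.not_mem_uncovered hx (e ▸ D.mem_uncovered),
          nH x hx h D.mem_uncovered⟩⟩
      exact hta (key x hx a haT hxa).1.symm
    exact fun x hx y hy hxy => h4.adj_of_compl_adj hxy (h1 x hx).1 (h1 x hx).2 (h1 y hy).1
      (h1 y hy).2 (M.compl_adj_end D.not_mem_left D.not_mem_right)
  have hut : ∀ {x}, x ∈ A ∨ x ∈ Q → x ≠ t := fun hx e => D.not_mem_tail hx (e ▸ htT)
  -- closed sets showing that `w` and `t` are articulation points
  have artw : IsArticulationPoint G w := isArticulationPoint_iff.2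
    (not_preconnected_of_closedIn cH D.mem_uncovered (D.ne_of_mem_right huC)
      (D.not_mem_uncovered huC))
  have cT : ClosedIn G {t}ᶜ {x | x ∈ T ∧ x ≠ t} := by
    refine ⟨fun x hx => hx.2, fun x hx y hy hxy => ?_⟩
    rcases D.mem_cases y with rfl | h1 | h1 | h1
    exacts [absurd (hwT x hx.1 hxy.symm) hx.2, absurd (key y h1 x hx.1 hxy.symm).1 hx.2, ⟨h1, hy⟩,
      absurd hxy (D.compl_adj_tail hG h4 hx.1 h1.1 h1.2).2]
  have artt : IsArticulationPoint G t := isArticulationPoint_iff.2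
    (not_preconnected_of_closedIn cT ⟨haT, hta.symm⟩ (hut huC) fun h => D.not_mem_tail huC h.1)
  -- two paths through the clique that leave it towards `w` and `t`
  have hnodup : (A ++ Q).Nodup :=
    M.nodup.sublist ((List.sublist_append_left A (w :: T)).append_right Q)
  have clq' : ∀ x ∈ A ++ Q, ∀ y ∈ A ++ Q, x ≠ y → G.Adj x y := fun x hx y hy =>
    clq x (List.mem_append.1 hx) y (List.mem_append.1 hy)
  have split : ∀ {e₁ e₂}, (e₁ ∈ A ∨ e₁ ∈ Q) → (e₂ ∈ A ∨ e₂ ∈ Q) → e₁ ≠ e₂ → e₁ ≠ v → e₂ ≠ u →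
      (e₁ = u → e₂ = v → ∀ x ∈ A ++ Q, x = u ∨ x = v) →
      (G.Adj e₁ t ∧ G.Adj e₂ w) ∨ (G.Adj e₁ w ∧ G.Adj e₂ t) → False := by
    intro e₁ e₂ m₁ m₂ h1 h2 h3 h5 h6
    obtain ⟨C₁, C₂, hp, s₁, s₂⟩ := exists_two_seg_of_clique hnodup clq' (List.mem_append.2 huC)
      (List.mem_append.2 hvC) (List.mem_append.2 m₁) (List.mem_append.2 m₂) huv h1 h2 h3 h5
    rcases h6 with ⟨a₁, a₂⟩ | ⟨a₁, a₂⟩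
    · refine M.false_of_perm D.not_mem_left D.not_mem_right (s₁.append D.seg a₁)
        ((s₂.concat a₂).concat D.adj) ?_
      classical
      refine List.perm_iff_count.2 fun z => ?_
      have := hp.count_eq z
      simp only [List.count_append, List.count_cons, List.count_nil] at this ⊢
      omega
    · refine M.false_of_perm D.not_mem_left D.not_mem_right ((s₁.concat a₁).concat D.adj)
        (s₂.append D.seg a₂) ?_
      classical
      refine List.perm_iff_count.2 fun z => ?_
      have := hp.count_eq z
      simp only [List.count_append, List.count_cons, List.count_nil] at this ⊢
      omega
  have hmC : m ∈ A ∨ m ∈ Q := .inl hm.last_mem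
  by_cases hsame : ∃ e, (e ∈ A ∨ e ∈ Q) ∧ G.Adj e t ∧ G.Adj e w ∧
      ∀ x, x ∈ A ∨ x ∈ Q → G.Adj x t ∨ G.Adj x w → x = e
  · -- `e`, `t`, `w` form a triangle of articulation points
    obtain ⟨e, heC, het, hew, huniq⟩ := hsame
    have out : ∀ {x}, x ∈ A ∨ x ∈ Q → x ≠ e → x ∉ ({e, t, w} : Set V) := by
      intro x hx hxe hmem
      rcases hmem with h1 | h1 | h1
      exacts [hxe h1, hut hx h1, D.ne_of_mem_right hx h1]
    have cC : ClosedIn G {e}ᶜ {x | (x ∈ A ∨ x ∈ Q) ∧ x ≠ e} := by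
      refine ⟨fun x hx => hx.2, fun x hx y hy hxy => ?_⟩
      rcases D.mem_cases y with rfl | h1 | h1 | h1
      · exact absurd (huniq x hx.1 (.inr hxy)) hx.2
      · exact ⟨h1, hy⟩
      · exact absurd (huniq x hx.1 (.inl ((key x hx.1 y h1 hxy).1 ▸ hxy))) hx.2
      · exact absurd hxy (nH x hx.1 y h1)
    obtain ⟨f, hfC, hfe⟩ : ∃ f, (f ∈ A ∨ f ∈ Q) ∧ f ≠ e := by
      by_cases hue : u = e
      · exact ⟨v, hvC, fun h => huv (hue.trans h.symm)⟩
      · exact ⟨u, huC, hue⟩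
    have arte : IsArticulationPoint G e := isArticulationPoint_iff.2
      (not_preconnected_of_closedIn cC ⟨hfC, hfe⟩ (b := t) (hut heC).symm
        fun h => D.not_mem_tail h.1 htT)
    have hB := hcB e t w arte artt artw het D.next.symm hew
    by_cases hue : u = e
    · have hve : v ≠ e := fun h => huv (hue.trans h.symm)
      obtain ⟨K, hK, hvK⟩ := exists_isComponent G (S := ({e, t, w} : Set V)ᶜ) (out hvC hve)
      exact (hB K hK).2.1 (by simp [hue]) (out hvC hve) ⟨v, hvK, clq u huC v hvC huv⟩ hvK
    by_cases hve : v = e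
    · obtain ⟨K, hK, huK⟩ := exists_isComponent G (S := ({e, t, w} : Set V)ᶜ) (out huC hue)
      exact (hB K hK).2.2 (by simp [hve]) (out huC hue) ⟨u, huK, clq v hvC u huC huv.symm⟩ huK
    obtain ⟨K, hK, huK⟩ := exists_isComponent G (S := ({e, t, w} : Set V)ᶜ) (out huC hue)
    exact (hB K hK).1 (out huC hue) (out hvC hve)
      ⟨huK, hK.closedIn.2 u huK v (out hvC hve) (clq u huC v hvC huv)⟩
  -- otherwise only `u` and `v` are adjacent to `t` or `w`
  have honly : ∀ x, x ∈ A ∨ x ∈ Q → G.Adj x t ∨ G.Adj x w → x = u ∨ x = v := by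
    intro e heC he
    by_contra! hcon
    have huniq : ∀ x, x ∈ A ∨ x ∈ Q → (G.Adj e t ∧ G.Adj x w) ∨ (G.Adj e w ∧ G.Adj x t) →
        x = e := by
      intro x hx hadj
      by_contra hxe
      by_cases hxu : x = u
      · exact split hx heC hxe (hxu ▸ huv) hcon.1 (fun _ h => absurd h hcon.2)
          (hadj.symm.imp And.symm And.symm)
      · exact split heC hx (Ne.symm hxe) hcon.2 hxu (fun h => absurd h hcon.1) hadj
    have het : G.Adj e t := by
      rcases he with he | he
      · exact he
      · exact huniq c hc (.inr ⟨he, hcy⟩) ▸ hcy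
    have hew : G.Adj e w := huniq m hmC (.inl ⟨het, hmw⟩) ▸ hmw
    exact hsame ⟨e, heC, het, hew, fun x hx hxa =>
      hxa.elim (fun h => huniq x hx (.inr ⟨hew, h⟩)) (fun h => huniq x hx (.inl ⟨het, h⟩))⟩
  -- a third vertex of the clique, which yields a violation of `CondD`
  obtain ⟨k, hkC, hku, hkv⟩ : ∃ k, (k ∈ A ∨ k ∈ Q) ∧ k ≠ u ∧ k ≠ v := by
    by_contra! hcon
    have hall : ∀ x, x ∈ A ∨ x ∈ Q → x = u ∨ x = v := fun x hx => by
      by_cases hxu : x = u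
      exacts [.inl hxu, .inr (hcon x hx hxu)]
    have hall' : ∀ x ∈ A ++ Q, x = u ∨ x = v := fun x hx => hall x (List.mem_append.1 hx)
    have suv : ¬ ((G.Adj u t ∧ G.Adj v w) ∨ (G.Adj u w ∧ G.Adj v t)) :=
      split huC hvC huv huv huv.symm (fun _ _ => hall')
    rcases hall c hc with rfl | rfl <;> rcases hall m hmC with rfl | rfl
    · refine hsame ⟨m, hc, hcy, hmw, fun x hx hxa => ?_⟩
      rcases hall x hx with h | rfl
      · exact h
      · exact absurd (hxa.elim (fun h => .inr ⟨hmw, h⟩) fun h => .inl ⟨hcy, h⟩) suv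
    · exact suv (.inl ⟨hcy, hmw⟩)
    · exact suv (.inr ⟨hmw, hcy⟩)
    · refine hsame ⟨m, hc, hcy, hmw, fun x hx hxa => ?_⟩
      rcases hall x hx with rfl | h
      · exact absurd (hxa.elim (fun h => .inl ⟨h, hmw⟩) fun h => .inr ⟨h, hcy⟩) suv
      · exact h
  have mQ : ∀ x, (x ∈ A ∨ x ∈ Q) ∨ x ∈ T → x ∈ ({w}ᶜ \ D.uncovered : Set V) := by
    rintro x (hx | hx)
    exacts [⟨D.ne_of_mem_right hx, D.not_mem_uncovered hx⟩,
      ⟨D.ne_of_mem_tail hx, D.not_mem_uncovered_of_tail hx⟩]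
  have mQ' : ∀ x ∈ ({w}ᶜ \ D.uncovered : Set V), (x ∈ A ∨ x ∈ Q) ∨ x ∈ T := by
    rintro x ⟨h1, h2⟩
    rcases D.mem_cases x with h | h | h | h
    exacts [absurd h h1, .inl h, .inr h, absurd h h2]
  have cQ := cH.diff
  generalize ({w}ᶜ \ D.uncovered : Set V) = Q₁ at cQ mQ mQ'
  have lC : ∀ {S : Set V}, (∀ x, x ∈ A ∨ x ∈ Q → x ∈ S) → ∀ x, x ∈ A ∨ x ∈ Q →
      Linked G S u x := fun hS x hx => Linked.of_seg hC (fun y hy => hS y (hC' y hy)) x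
    (by simpa using hx)
  have lQ : ∀ x ∈ Q₁, Linked G {w}ᶜ u x := by
    intro x hx
    rcases mQ' x hx with h1 | h1
    · exact lC (fun y hy => D.ne_of_mem_right hy) x h1
    · refine (lC (fun y hy => D.ne_of_mem_right hy) c hc).trans
        ((Linked.of_adj hcy (D.ne_of_mem_tail htT)).trans ?_)
      rcases eq_or_ne t x with rfl | hne
      · exact .refl _
      · exact .of_adj (D.tail_clique hG h4 t htT x h1 hne) (D.ne_of_mem_tail h1)
  have cJ : ClosedIn G (Q₁ \ {t}) {x | x ∈ A ∨ x ∈ Q} := by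
    refine ⟨fun x hx => ⟨mQ x (.inl hx), hut hx⟩, fun x hx y hy hxy => ?_⟩
    exact (mQ' y hy.1).resolve_right fun h => hy.2 (key x hx y h hxy).1
  have hJ := isComponent_of_linked cJ huC (lC cJ.1)
  have huQ := mQ u (.inl huC)
  have hQ₁ := isComponent_of_linked cQ huQ lQ
  have arty : IsArticulationPointOf G Q₁ t := ⟨mQ t (.inr htT),
    not_preconnected_of_closedIn cJ huC ⟨mQ a (.inr haT), hta.symm⟩
      fun h => D.not_mem_tail h haT⟩
  obtain ⟨x', hx', h1, h2, h3⟩ := hcD w (D.ne_of_mem_right huC).symm artw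
    (hcA.numComponents_le artw hQ₁ huQ (mQ v (.inl hvC))) Q₁ hQ₁ huQ t (hut huC).symm arty
    {x | x ∈ A ∨ x ∈ Q} hJ huC hvC (two_lt_ncard_of_mem huC hvC hkC huv hku.symm hkv.symm)
    (by
      intro x hx hwx
      rcases mQ' x hx with h | h
      exacts [.inl h, .inr (hwT x h hwx)])
  rcases honly x' hx' h3.symm with h | h
  exacts [h1 h, h2 h]

/-- An uncovered vertex with a neighbour on the first path leads to a violated condition. -/
theorem false_of_conds [Finite V] (D : Attached G u v A w T Q t a b h) (hG : G.Preconnected)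
    (h4 : KOneFree G 4) (hcA : CondA G u v) (hcB : CondB G u v) (hcC : CondC G u v)
    (hcD : CondD G u v) : False := by
  by_cases hQ : ∀ x ∈ Q, ∀ y ∈ D.uncovered, ¬ G.Adj x y
  · by_cases hne : A = []
    · subst hne
      obtain rfl := D.pair.left.eq_of_nil_append
      exact D.false_of_init_nil hG h4 hQ hcA hcC
    · exact D.false_of_init_ne_nil hG h4 hQ hne hcA hcB hcD
  · push Not at hQ
    obtain ⟨z, hz, y, hy, hzy⟩ := hQ
    obtain ⟨B, S, s, rfl, D'⟩ := D.pair.symm.exists_attached hy.2 hy.1 hz hzy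
    exact D.false_of_both D' hG h4 hcA hcC hcD

end Attached

theorem exists_isCover [Finite V] (hG : G.Preconnected) (h4 : KOneFree G 4) (huv : u ≠ v)
    (hcA : CondA G u v) (hcB : CondB G u v) (hcC : CondC G u v) (hcD : CondD G u v) :
    ∃ P Q a b, IsCover G u v P Q a b := by
  obtain ⟨P, Q, a, b, M⟩ := exists_maxPair G huv
  refine ⟨P, Q, a, b, M.left, M.right, M.nodup, fun h => ?_⟩
  by_contra! hh
  obtain ⟨w, k, hw | hw, hkP, hkQ, hwk⟩ := M.exists_adj_uncovered hG hh.1 hh.2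
  · obtain ⟨A, T, t, rfl, D⟩ := M.exists_attached hkP hkQ hw hwk
    exact D.false_of_conds hG h4 hcA hcB hcC hcD
  · obtain ⟨A, T, t, rfl, D⟩ := M.symm.exists_attached hkQ hkP hw hwk
    exact D.false_of_conds hG h4 hcA.symm hcB.symm hcC.symm hcD.symm

end OneSided

/-! ### Disconnected graphs -/

section Disconnected

variable {U : Set V} {u v a c e f : V} {l P Q : List V}

/-- In a connected graph `G[U]` without three independent vertices, every vertex `v` which is not
an articulation point is the start of a Hamiltonian path. -/
theorem exists_hamiltonian_seg [Finite V] (hv : v ∈ U)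
    (hα : ∀ x ∈ U, ∀ y ∈ U, ∀ z ∈ U, Gᶜ.Adj x y → Gᶜ.Adj x z → Gᶜ.Adj y z → False)
    (hU : ∀ x ∈ U, Linked G U v x) (hart : ¬ IsArticulationPointOf G U v) :
    ∃ l e, Seg G l v e ∧ l.Nodup ∧ ∀ x, x ∈ l ↔ x ∈ U := by
  have := Fintype.ofFinite V
  let p : ℕ → Prop := fun n => ∃ l e, Seg G l v e ∧ l.Nodup ∧ (∀ x ∈ l, x ∈ U) ∧ l.length = n
  have hb : ∀ n, p n → n ≤ Fintype.card V := by
    rintro _ ⟨l, e, _, hn, _, rfl⟩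
    exact hn.length_le_card
  have h1 : p 1 := ⟨[v], v, .single v, by simp, by simpa using hv, rfl⟩
  classical
  obtain ⟨l, e, hl, hn, hlU, hlen⟩ := Nat.findGreatest_spec (P := p) (hb 1 h1) h1
  have hmax : ∀ {l' e' k}, Seg G l' v e' → l'.Perm (k :: l) → k ∈ U → k ∉ l → False := by
    intro l' e' k hl' hp hk hkl
    have h2 : p l'.length := ⟨l', e', hl', hp.nodup_iff.2 (List.nodup_cons.2 ⟨hkl, hn⟩),
      fun x hx => (List.mem_cons.1 (hp.mem_iff.1 hx)).elim (fun h => h ▸ hk) (hlU x), rfl⟩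
    have h3 := Nat.le_findGreatest (hb _ h2) h2
    rw [hp.length_eq, List.length_cons, hlen] at h3
    omega
  refine ⟨l, e, hl, hn, fun x => ⟨hlU x, fun hx => ?_⟩⟩
  by_contra hxl
  obtain ⟨l', rfl⟩ := hl.eq_cons
  -- a neighbour `w ≠ v` of an uncovered vertex
  obtain ⟨w, hw, k, hkU, hkl, hwk⟩ : ∃ w ∈ l', ∃ k ∈ U, k ∉ v :: l' ∧ G.Adj w k := by
    by_contra! hc
    rcases eq_or_ne l' [] with rfl | hne
    · have hcl : ClosedIn G U {v} := by
        refine ⟨by simpa using hv, ?_⟩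
        rintro w rfl b hb hab
        by_contra hbw
        exact hmax ((Seg.single w).concat hab) (List.Perm.swap _ _ _) hb (by simpa using hbw)
      exact hxl (by simpa using hU x hx _ hcl rfl)
    · have hvl := (List.nodup_cons.1 hn).1
      have hcl : ClosedIn G (U \ {v}) {y | y ∈ l'} := by
        refine ⟨fun y hy => ⟨hlU y (List.mem_cons_of_mem _ hy), ?_⟩, fun y hy b hb hyb => ?_⟩
        · rintro rfl
          exact hvl hy
        · by_contra hbl
          exact hc y hy b hb.1 (by simpa using ⟨hb.2, hbl⟩) hyb
      obtain ⟨y, hy⟩ := List.exists_mem_of_ne_nil _ hne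
      refine hart ⟨hv, not_preconnected_of_closedIn hcl hy (b := x) ⟨hx, ?_⟩ ?_⟩
      · rintro rfl
        exact hxl (by simp)
      · exact fun h => hxl (List.mem_cons_of_mem _ h)
  obtain ⟨A, T, rfl⟩ := List.append_of_mem hw
  have hl₁ : Seg G ((v :: A) ++ w :: T) v e := hl
  obtain ⟨m, hm, hmw⟩ := hl₁.init_of_append (by simp)
  have hT : T ≠ [] := by
    rintro rfl
    rw [hl₁.eq_of_append_nil] at hwk
    refine hmax (hl.concat hwk) ?_ hkU hkl
    exact List.perm_append_singleton _ _
  obtain ⟨t, ht, hwt⟩ := hl₁.right_of_append hT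
  have hml : m ∈ v :: (A ++ w :: T) := by
    have := hm.last_mem
    simp only [List.mem_cons, List.mem_append] at this ⊢
    tauto
  have hmk : Gᶜ.Adj m k := by
    rw [compl_adj]
    refine ⟨fun h => hkl (h ▸ hml), fun hmk => ?_⟩
    refine hmax ((hm.concat hmk).append (ht.cons hwt) hwk.symm) ?_ hkU hkl
    refine List.perm_iff_count.2 fun z => ?_
    simp only [List.count_append, List.count_cons, List.count_nil]
    omega
  have hek : Gᶜ.Adj e k := by
    rw [compl_adj]
    refine ⟨fun h => hkl (h ▸ hl.last_mem), fun hek => ?_⟩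
    exact hmax (hl.concat hek) (List.perm_append_singleton _ _) hkU hkl
  have hme : m ≠ e := by
    rintro rfl
    have hn' : ((v :: A) ++ w :: T).Nodup := hn
    exact List.disjoint_of_nodup_append hn' hm.last_mem (by simp [ht.last_mem])
  have hadj : G.Adj m e := by
    by_contra h
    exact hα m (hlU m hml) e (hlU e hl.last_mem) k hkU ((compl_adj G m e).2 ⟨hme, h⟩) hmk hek
  refine hmax (((hm.append ht.reverse hadj).concat hwt.symm).concat hwk) ?_ hkU hkl
  refine List.perm_iff_count.2 fun z => ?_
  simp only [List.count_append, List.count_cons, List.count_nil, List.count_reverse]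
  omega

theorem Seg.reachable (h : Seg G l a e) (hc : c ∈ l) : G.Reachable a c :=
  Linked.of_seg h (fun _ _ => Set.mem_univ _) c hc {x | G.Reachable a x}
    ⟨Set.subset_univ _, fun _ hx _ _ hxy => hx.trans hxy.reachable⟩ (Reachable.refl a)

theorem linked_of_reachable (h : G.Reachable a c) :
    Linked G (G.connectedComponentMk a).supp a c := by
  intro A hA
  obtain ⟨p⟩ := h
  have : ∀ {x y} (_ : G.Walk x y), x ∈ A → y ∈ A := by
    intro x y p
    induction p with
    | nil => exact id
    | cons hxy _ ih =>
      exact fun hx => ih (hA.2 _ hx _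
        (ConnectedComponent.mem_supp_of_adj_mem_supp _ (hA.1 hx) hxy) hxy)
  exact this p

namespace IsCover

theorem mk_eq (h : IsCover G u v P Q e f) (x : V) :
    G.connectedComponentMk x = G.connectedComponentMk u ∨
      G.connectedComponentMk x = G.connectedComponentMk v := by
  rcases h.cover x with hx | hx
  · exact .inl (ConnectedComponent.sound (h.left.reachable hx).symm)
  · exact .inr (ConnectedComponent.sound (h.right.reachable hx).symm)

theorem not_isArticulationPointOf (h : IsCover G u v P Q e f)
    (huv : G.connectedComponentMk u ≠ G.connectedComponentMk v) :
    ¬ IsArticulationPointOf G (G.connectedComponentMk u).supp u := by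
  rintro ⟨-, hn⟩
  refine hn ?_
  obtain ⟨P', rfl⟩ := h.left.eq_cons
  have hmem : ∀ x ∈ (G.connectedComponentMk u).supp \ {u}, x ∈ P' := by
    rintro x ⟨hx, hxu⟩
    rcases h.cover x with hxP | hxQ
    · exact (List.mem_cons.1 hxP).resolve_left hxu
    · exact absurd (hx.symm.trans (ConnectedComponent.sound (h.right.reachable hxQ).symm)) huv
  have hmem' : ∀ x ∈ P', x ∈ (G.connectedComponentMk u).supp \ {u} := by
    intro x hx
    refine ⟨ConnectedComponent.sound (h.left.reachable (List.mem_cons_of_mem _ hx)).symm, ?_⟩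
    rintro rfl
    exact (List.nodup_cons.1 (List.Nodup.of_append_left h.nodup)).1 hx
  intro x y
  obtain ⟨t, ht, -⟩ := Seg.right_of_append (l₁ := []) h.left
    (List.ne_nil_of_mem (hmem x x.2))
  have hl := Linked.of_seg ht hmem'
  exact reachable_iff_linked.2 (((hl x (hmem x x.2)).symm (hmem' t ht.head_mem)).trans
    (hl y (hmem y y.2)))

end IsCover

theorem hasPC_iff_exists_isCover : HasPC G u v ↔ ∃ P Q a b, IsCover G u v P Q a b := by
  rw [hasPC_iff]
  constructor
  · rintro ⟨P, Q, a, b, h1, h2, h3, h4⟩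
    exact ⟨P, Q, a, b, h1, h2, h3, h4⟩
  · rintro ⟨P, Q, a, b, h1, h2, h3, h4⟩
    exact ⟨P, Q, a, b, h1, h2, h3, h4⟩

/-- A component is covered by a path from any of its vertices which is not an articulation point:
together with a vertex of another component, three independent vertices in it would contradict
`4K₁`-freeness. -/
theorem exists_seg_connectedComponent [Finite V] (h4 : KOneFree G 4)
    (huv : G.connectedComponentMk u ≠ G.connectedComponentMk v)
    (hart : ¬ IsArticulationPointOf G (G.connectedComponentMk u).supp u) :
    ∃ l e, Seg G l u e ∧ l.Nodup ∧ ∀ x, x ∈ l ↔ x ∈ (G.connectedComponentMk u).supp := by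
  refine exists_hamiltonian_seg rfl (fun x hx y hy z hz hxy hxz hyz => ?_)
    (fun x hx => linked_of_reachable (ConnectedComponent.exact hx).symm) hart
  have key : ∀ x ∈ (G.connectedComponentMk u).supp, Gᶜ.Adj x v := by
    intro x hx
    rw [compl_adj]
    refine ⟨?_, fun hxv => huv (hx.symm.trans (ConnectedComponent.sound hxv.reachable))⟩
    rintro rfl
    exact huv hx.symm
  exact h4.false_of_compl_adj hxy hxz (key x hx) hyz (key y hy) (key z hz)

end Disconnected

end PathCover

theorem theorem6 {V : Type*} [Finite V] (G : SimpleGraph V) (hG : PathCover.KOneFree G 4)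
    (u v : V) (huv : u ≠ v) :
    (G.Connected →
      (PathCover.HasPC G u v ↔
        PathCover.CondA G u v ∧ PathCover.CondB G u v ∧
          PathCover.CondC G u v ∧ PathCover.CondD G u v)) ∧
    (¬ G.Connected →
      (PathCover.HasPC G u v ↔
        Nat.card G.ConnectedComponent = 2 ∧
          G.connectedComponentMk u ≠ G.connectedComponentMk v ∧
          ¬ PathCover.IsArticulationPointOf G (G.connectedComponentMk u).supp u ∧
          ¬ PathCover.IsArticulationPointOf G (G.connectedComponentMk v).supp v)) := by
  rw [PathCover.hasPC_iff_exists_isCover]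
  refine ⟨fun hconn => ⟨?_, ?_⟩, fun hconn => ⟨?_, ?_⟩⟩
  · rintro ⟨P, Q, a, b, h⟩
    exact ⟨h.condA huv, h.condB hconn.preconnected, h.condC, h.condD⟩
  · rintro ⟨hA, hB, hC, hD⟩
    exact PathCover.exists_isCover hconn.preconnected hG huv hA hB hC hD
  · rintro ⟨P, Q, a, b, h⟩
    have hne : G.connectedComponentMk u ≠ G.connectedComponentMk v := by
      intro he
      have hr : ∀ x, G.Reachable x u := fun x =>
        ConnectedComponent.exact ((h.mk_eq x).elim id fun hx => hx.trans he.symm)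
      have : Nonempty V := ⟨u⟩
      exact hconn ⟨fun x y => (hr x).trans (hr y).symm⟩
    refine ⟨Nat.card_eq_two_iff.2 ⟨_, _, hne, ?_⟩, hne, h.not_isArticulationPointOf hne,
      h.symm.not_isArticulationPointOf hne.symm⟩
    refine Set.eq_univ_of_forall fun c => ?_
    induction c using ConnectedComponent.ind with
    | h x => exact h.mk_eq x
  · rintro ⟨hcard, hne, hu, hv⟩
    obtain ⟨P, a, hP, nP, mP⟩ := PathCover.exists_seg_connectedComponent hG hne hu
    obtain ⟨Q, b, hQ, nQ, mQ⟩ := PathCover.exists_seg_connectedComponent hG hne.symm hv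
    refine ⟨P, Q, a, b, hP, hQ, List.nodup_append'.2 ⟨nP, nQ, fun x hx hx' => ?_⟩, fun x => ?_⟩
    · exact hne (((mP x).1 hx).symm.trans ((mQ x).1 hx'))
    · obtain ⟨c, d, -, hcd⟩ := Nat.card_eq_two_iff.1 hcard
      have hm : ∀ e : G.ConnectedComponent, e = c ∨ e = d := fun e => by
        simpa using hcd.symm.subset (Set.mem_univ e)
      rw [mP, mQ, ConnectedComponent.mem_supp_iff, ConnectedComponent.mem_supp_iff]
      rcases hm (G.connectedComponentMk u) with h1 | h1 <;>
      rcases hm (G.connectedComponentMk v) with h2 | h2 <;>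
      rcases hm (G.connectedComponentMk x) with h3 | h3 <;> simp_all
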